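/- Let $d\ge 3$. There is a constant $\sigma_0>0$, depending only on $d$, such that the following holds. Let $x_n\in\mathbb R^d$, $n\ge 1$, be arbitrary points with $|x_n|=2^n$, and let $B_n=\{y\in\mathbb R^d:\ |y-x_n|<2^n/3\}$ (these balls are pairwise disjoint). Let $V:\mathbb R^d\to\mathbb R$ be an arbitrary measurable potential with $V(y)\ge |y|^{-2}$ for almost every $y\in B_n$, for all $n\ge1$. Then for every $\sigma>\sigma_0$: (i) If $V$ is essentially bounded and vanishes at infinity (for each $\varepsilon>0$ there is $R$ such that $|V(y)|\le\varepsilon$ for a.e. $|y|\ge R$), then the operator $H=-\Delta-\sigma V$ in $L^2(\mathbb R^d)$ with domain $H^2(\mathbb R^d)$ has infinitely many negative eigenvalues. (ii) More generally, let $V$ be possibly unbounded and non-decaying, with $V\in L^2_{\rm loc}(\mathbb R^d)$, and let $H$ be any self-adjoint operator in $L^2(\mathbb R^d)$ whose domain contains $C_c^\infty(\mathbb R^d)$ and which satisfies $Hf=-\Delta f-\sigma Vf$ for $f\in C_c^\infty(\mathbb R^d)$. If the negative spectrum of $H$ is discrete (every point of the spectrum in $(-\infty,0)$ is an isolated point of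 the spectrum and an eigenvalue of finite multiplicity), then $H$ has infinitely many negative eigenvalues. -/

import Mathlib

open MeasureTheory Filter Topology TemperedDistribution
open scoped ENNReal ContDiff Laplacian SchwartzMap

noncomputable section

namespace LargeSpots

section Operators

variable {E : Type*} [NormedAddCommGroup E] [NormedSpace ℂ E]

/-- The operator `T - z`, defined on the domain of the unbounded operator `T`. -/
def shift (T : E →ₗ.[ℂ] E) (z : ℂ) : T.domain →ₗ[ℂ] E :=
  T.toFun - z • T.domain.subtype

/-- `ker (T - z)`, as a subspace of the domain of `T`. -/
def eigenspace (T : E →ₗ.[ℂ] E) (z : ℂ) : Submodule ℂ T.domain :=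
  LinearMap.ker (shift T z)

/-- `z` is an eigenvalue of the unbounded operator `T`. -/
def HasEigenvalue (T : E →ₗ.[ℂ] E) (z : ℂ) : Prop :=
  eigenspace T z ≠ ⊥

/-- The resolvent set of `T`: the `z` for which `T - z` is a bijection from the domain of `T` onto
the whole space whose inverse `R` is bounded. -/
def resolventSet (T : E →ₗ.[ℂ] E) : Set ℂ :=
  {z | ∃ R : E →L[ℂ] E,
    (∀ f : E, ∃ u : T.domain, (u : E) = R f ∧ shift T z u = f) ∧
    ∀ u : T.domain, R (shift T z u) = u}

/-- The spectrum of an unbounded operator. -/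
def spectrum (T : E →ₗ.[ℂ] E) : Set ℂ :=
  (resolventSet T)ᶜ

/-- The negative spectrum of `T` is discrete: each negative point of the spectrum is an isolated
point of the spectrum and an eigenvalue of finite multiplicity. -/
def DiscreteNegativeSpectrum (T : E →ₗ.[ℂ] E) : Prop :=
  ∀ t : ℝ, t < 0 → (t : ℂ) ∈ spectrum T →
    (∀ᶠ z in 𝓝[≠] (t : ℂ), z ∉ spectrum T) ∧
    HasEigenvalue T t ∧ FiniteDimensional ℂ (eigenspace T t)

/-- The set of negative eigenvalues of `T`. -/
def negativeEigenvalues (T : E →ₗ.[ℂ] E) : Set ℝ :=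
  {t | t < 0 ∧ HasEigenvalue T t}

end Operators

/-- The Hilbert space `L²(ℝᵈ; ℂ)`. -/
abbrev L2 (d : ℕ) : Type :=
  Lp ℂ 2 (volume : Measure (EuclideanSpace ℝ (Fin d)))

/-- An `L²` function as a tempered distribution. -/
abbrev toDistr (d : ℕ) : L2 d →L[ℂ] 𝓢'(EuclideanSpace ℝ (Fin d), ℂ) :=
  Lp.toTemperedDistributionCLM ℂ volume 2

theorem toDistr_injective (d : ℕ) : Function.Injective (toDistr d) :=
  LinearMap.ker_eq_bot.mp (Lp.ker_toTemperedDistributionCLM_eq_bot)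

/-- The Sobolev space `H²(ℝᵈ)` as a subspace of `L²(ℝᵈ)`. -/
def sobolevH2 (d : ℕ) : Submodule ℂ (L2 d) where
  carrier := {ψ | MemSobolev 2 2 (toDistr d ψ)}
  add_mem' hf hg := by
    simpa only [Set.mem_ofPred_eq, map_add] using hf.add hg
  zero_mem' := by
    simp only [Set.mem_ofPred_eq, map_zero, memSobolev_fun_zero]
  smul_mem' c f hf := by
    simpa only [Set.mem_ofPred_eq, map_smul] using hf.smul c

/-- The distributional Laplacian of an `H²` function is an `L²` function. -/
theorem exists_laplacian (d : ℕ) (ψ : sobolevH2 d) :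
    ∃ g : L2 d, toDistr d g = Δ (toDistr d ψ) := by
  have h := MemSobolev.laplacian (show MemSobolev 2 2 (toDistr d ψ) from ψ.2)
  rw [sub_self, memSobolev_zero_iff] at h
  obtain ⟨g, hg⟩ := h
  exact ⟨g, hg.symm⟩

/-- The Laplacian `Δ : H²(ℝᵈ) → L²(ℝᵈ)`, taken in the sense of distributions. -/
def laplacianL2 (d : ℕ) : sobolevH2 d →ₗ[ℂ] L2 d where
  toFun ψ := (exists_laplacian d ψ).choose
  map_add' ψ φ := by
    apply toDistr_injective
    rw [map_add, (exists_laplacian d (ψ + φ)).choose_spec, (exists_laplacian d ψ).choose_spec,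
      (exists_laplacian d φ).choose_spec, Submodule.coe_add, map_add,
      ← TemperedDistribution.laplacianCLM_apply, map_add]
    simp only [TemperedDistribution.laplacianCLM_apply]
  map_smul' c ψ := by
    apply toDistr_injective
    rw [map_smul, (exists_laplacian d (c • ψ)).choose_spec, (exists_laplacian d ψ).choose_spec,
      Submodule.coe_smul, map_smul, ← TemperedDistribution.laplacianCLM_apply, map_smul,
      TemperedDistribution.laplacianCLM_apply, RingHom.id_apply]

theorem toDistr_laplacianL2 (d : ℕ) (ψ : sobolevH2 d) :
    toDistr d (laplacianL2 d ψ) = Δ (toDistr d ψ) :=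
  (exists_laplacian d ψ).choose_spec

/-- The maximal domain `{ψ ∈ L² : Vψ ∈ L²}` of multiplication by `V`. -/
def mulDomain {d : ℕ} (V : EuclideanSpace ℝ (Fin d) → ℝ) : Submodule ℂ (L2 d) where
  carrier := {ψ | MemLp (fun x => (V x : ℂ) * ψ x) 2 volume}
  add_mem' {f g} hf hg := by
    refine (MemLp.add hf hg).ae_eq ?_
    filter_upwards [Lp.coeFn_add f g] with x hx
    simp only [Pi.add_apply, hx, mul_add]
  zero_mem' := by
    refine (MemLp.zero' (ε := ℂ)).ae_eq ?_
    filter_upwards [Lp.coeFn_zero ℂ 2 (volume : Measure (EuclideanSpace ℝ (Fin d)))] with x hx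
    simp only [hx, Pi.zero_apply, mul_zero]
  smul_mem' c f hf := by
    refine (MemLp.const_smul hf c).ae_eq ?_
    filter_upwards [Lp.coeFn_smul c f] with x hx
    simp only [Pi.smul_apply, hx, smul_eq_mul]
    ring

/-- Multiplication by `V` on its maximal domain. -/
def mulOp {d : ℕ} (V : EuclideanSpace ℝ (Fin d) → ℝ) : mulDomain V →ₗ[ℂ] L2 d where
  toFun ψ := MemLp.toLp (fun x => (V x : ℂ) * (ψ : L2 d) x) ψ.2
  map_add' f g := by
    apply Lp.ext
    filter_upwards [MemLp.coeFn_toLp (f + g).2, MemLp.coeFn_toLp f.2, MemLp.coeFn_toLp g.2,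
      Lp.coeFn_add (f : L2 d) (g : L2 d),
      Lp.coeFn_add (MemLp.toLp _ f.2) (MemLp.toLp _ g.2)] with x h1 h2 h3 h4 h5
    rw [h1, h5, Pi.add_apply, h2, h3, Submodule.coe_add, h4, Pi.add_apply, mul_add]
  map_smul' c f := by
    apply Lp.ext
    filter_upwards [MemLp.coeFn_toLp (c • f).2, MemLp.coeFn_toLp f.2,
      Lp.coeFn_smul c (f : L2 d), Lp.coeFn_smul c (MemLp.toLp _ f.2)] with x h1 h2 h3 h4
    rw [h1, RingHom.id_apply, h4, Pi.smul_apply, h2, Submodule.coe_smul, h3, Pi.smul_apply,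
      smul_eq_mul, smul_eq_mul]
    ring

/-- The Schrödinger operator `-Δ - σV` in `L²(ℝᵈ)`, with domain `{ψ ∈ H² : Vψ ∈ L²}`. For bounded
measurable `V` the domain is `H²(ℝᵈ)`. -/
def schrodinger {d : ℕ} (σ : ℝ) (V : EuclideanSpace ℝ (Fin d) → ℝ) : L2 d →ₗ.[ℂ] L2 d where
  domain := sobolevH2 d ⊓ mulDomain V
  toFun := -(laplacianL2 d ∘ₗ Submodule.inclusion inf_le_left) -
    (σ : ℂ) • (mulOp V ∘ₗ Submodule.inclusion inf_le_right)

/-- `H` is a self-adjoint realization of `-Δ - σV` in `L²(ℝᵈ)`: it is self-adjoint, its domain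
contains every test function `f ∈ C_c^∞(ℝᵈ)`, and `H f = -Δ f - σ V f`. -/
def IsSelfAdjointRealization {d : ℕ} (σ : ℝ) (V : EuclideanSpace ℝ (Fin d) → ℝ)
    (H : L2 d →ₗ.[ℂ] L2 d) : Prop :=
  IsSelfAdjoint H ∧
    ∀ f : EuclideanSpace ℝ (Fin d) → ℂ, ContDiff ℝ ∞ f → HasCompactSupport f →
      ∃ ψ : H.domain, ((ψ : L2 d) : EuclideanSpace ℝ (Fin d) → ℂ) =ᵐ[volume] f ∧
        (H ψ : EuclideanSpace ℝ (Fin d) → ℂ) =ᵐ[volume]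
          fun x => -(Δ f) x - (σ : ℂ) * ((V x : ℂ) * f x)

/-- `V` tends to zero at infinity, up to null sets. -/
def VanishesAtInfinity {d : ℕ} (V : EuclideanSpace ℝ (Fin d) → ℝ) : Prop :=
  ∀ ε : ℝ, 0 < ε → ∃ R : ℝ, ∀ᵐ x, R ≤ ‖x‖ → |V x| ≤ ε

end LargeSpots

end

open scoped InnerProductSpace

noncomputable section

namespace LargeSpots

/-! ### Negative eigenvalues from a negative form: the abstract criterion -/

section Abstract

variable {E : Type*} [NormedAddCommGroup E] [InnerProductSpace ℂ E]

/-! A fixed bump function, rescaled to the closed ball of radius `2^n / 4` about `x n`, has kinetic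
energy of order `2^(-2n)` times its squared norm. There `V` is at least `9/16 * 2^(-2n)`, so one
`σ₀` makes the form of `H` negative on all these functions (`re_inner_spot_lt_zero`). Their supports
are disjoint and `H` acts locally on them, so they are also orthogonal for the form
(`inner_spot_eq_zero`).

The spectral step is `infinite_negativeEigenvalues`. Suppose there are finitely many negative
eigenvalues, and let `R = (T - t)⁻¹` for some `t < 0` that is not one of them. With `f = (T - t) u`,
the form at `u` is `⟪f, (R + t R²) f⟫`. The negative part `G` of `R + t R²` lives on finitely many
eigenvalues of finite multiplicity, so it has finite rank. Some nontrivial combination `u` of the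
test vectors then satisfies `G (T - t) u = 0`, hence has nonnegative form, whereas
form-orthogonality makes the form negative at `u`.

For (ii), discreteness supplies the spectral input. For (i) it comes from the factorization `H - t =
(1 - K)(-Δ - t)`, `K = σ V (-Δ - t)⁻¹`: here `K` is compact, and the Fredholm alternative applies
(`hasEigenvalue_schrodinger`). -/

theorem shift_apply (T : E →ₗ.[ℂ] E) (z : ℂ) (u : T.domain) :
    shift T z u = T u - z • (u : E) := rfl

theorem mem_eigenspace_iff (T : E →ₗ.[ℂ] E) (z : ℂ) (u : T.domain) :
    u ∈ eigenspace T z ↔ T u = z • (u : E) := by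
  rw [eigenspace, LinearMap.mem_ker, shift_apply, sub_eq_zero]

/-- `R` is a bounded inverse of `T - z`. -/
def IsResolvent (T : E →ₗ.[ℂ] E) (z : ℂ) (R : E →L[ℂ] E) : Prop :=
  (∀ f : E, ∃ u : T.domain, (u : E) = R f ∧ shift T z u = f) ∧
    ∀ u : T.domain, R (shift T z u) = u

theorem IsResolvent.isSelfAdjoint [CompleteSpace E] {T : E →ₗ.[ℂ] E} {t : ℝ} {R : E →L[ℂ] E}
    (hR : IsResolvent T t R)
    (hsym : ∀ u v : T.domain, ⟪T u, (v : E)⟫_ℂ = ⟪(u : E), T v⟫_ℂ) : IsSelfAdjoint R := by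
  rw [ContinuousLinearMap.isSelfAdjoint_iff_isSymmetric]
  intro f g
  obtain ⟨u, hu, rfl⟩ := hR.1 f
  obtain ⟨v, hv, rfl⟩ := hR.1 g
  simp only [ContinuousLinearMap.coe_coe]
  rw [← hu, ← hv, shift_apply, shift_apply, inner_sub_left, inner_sub_right, hsym,
    inner_smul_left, inner_smul_right, Complex.conj_ofReal]

/-- The spectral mapping property of the resolvent. -/
theorem IsResolvent.mem_spectrum_of_mem_spectrum {T : E →ₗ.[ℂ] E} {t : ℂ} {R : E →L[ℂ] E}
    (hR : IsResolvent T t R) {x : ℂ} (hx : x ≠ 0) (hxR : x ∈ _root_.spectrum ℂ R) :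
    t + x⁻¹ ∈ spectrum T := by
  rintro ⟨S, hS1, hS2⟩
  apply hxR
  rw [_root_.spectrum.mem_resolventSet_iff]
  have hshift (u : T.domain) : shift T t u = shift T (t + x⁻¹) u + x⁻¹ • (u : E) := by
    simp only [shift_apply]; module
  -- The resolvent identity `S - R = x⁻¹ R S`, in both orders.
  have h1 (f : E) : R f + x⁻¹ • R (S f) = S f := by
    obtain ⟨u, hu, hf⟩ := hS1 f
    have := hR.2 u
    rw [hshift, hf, map_add, map_smul, hu] at this
    exact this
  have h2 (f : E) : R f + x⁻¹ • S (R f) = S f := by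
    obtain ⟨u, hu, hf⟩ := hR.1 f
    have := hS2 u
    have e : shift T (t + x⁻¹) u = f - x⁻¹ • (u : E) := by rw [← hf, hshift]; abel
    rw [e, map_sub, map_smul, hu, sub_eq_iff_eq_add] at this
    exact this.symm
  -- With `τ = T - t`, formally `(x - τ⁻¹)⁻¹ = x⁻¹ τ (τ - x⁻¹)⁻¹ = x⁻¹ (1 + x⁻¹ S)`.
  refine ⟨⟨algebraMap ℂ _ x - R, x⁻¹ • (1 + x⁻¹ • S), ?_, ?_⟩, rfl⟩
  · ext f
    have e : R f = S f - x⁻¹ • R (S f) := eq_sub_of_add_eq (h1 f)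
    simp only [mul_apply_eq_comp, _root_.sub_apply,
      _root_.smul_apply, _root_.add_apply, map_smul, map_add,
      one_apply_eq_self, Algebra.algebraMap_eq_smul_one]
    simp only [smul_add, smul_sub, smul_smul, e]
    match_scalars <;> field_simp <;> ring
  · ext f
    have e : R f = S f - x⁻¹ • S (R f) := eq_sub_of_add_eq (h2 f)
    simp only [mul_apply_eq_comp, _root_.sub_apply,
      _root_.smul_apply, _root_.add_apply, map_smul, map_sub,
      one_apply_eq_self, Algebra.algebraMap_eq_smul_one]
    have e' : S (R f) = x • S f - x • R f := by
      rw [← smul_sub, ← h2 f, add_sub_cancel_left, smul_inv_smul₀ hx]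
    simp only [smul_add, smul_sub, smul_smul, e']
    match_scalars <;> field_simp <;> ring

/-- A product of translates of an operator by some of its eigenvalues has a finite-dimensional kernel
if all the eigenspaces are finite-dimensional. -/
theorem finiteDimensional_ker_aeval_prod (R : E →L[ℂ] E) (s : Finset ℝ)
    (h : ∀ x ∈ s, FiniteDimensional ℂ (R - algebraMap ℝ (E →L[ℂ] E) x).ker) :
    FiniteDimensional ℂ
      (Polynomial.aeval R (∏ x ∈ s, (Polynomial.X - Polynomial.C x))).ker := by
  suffices H : ∀ A : E →L[ℂ] E,
      A = Polynomial.aeval R (∏ x ∈ s, (Polynomial.X - Polynomial.C x)) →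
        FiniteDimensional ℂ A.ker from H _ rfl
  induction s using Finset.induction_on with
  | empty =>
    rintro A hA
    have : A.ker = ⊥ := by ext; simp [hA]
    rw [this]
    infer_instance
  | insert a s ha ih =>
    rintro A hA
    have h1 := ih (fun x hx => h x (Finset.mem_insert_of_mem hx)) _ rfl
    have h2 := h a (Finset.mem_insert_self a s)
    rw [Finset.prod_insert ha, mul_comm, map_mul, map_sub, Polynomial.aeval_X,
      Polynomial.aeval_C] at hA
    -- The preimage of a finite-dimensional subspace under a map with finite-dimensional kernel is
    -- finite-dimensional.
    refine Submodule.finiteDimensional_of_le (S₂ := Submodule.comap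
      (R - algebraMap ℝ (E →L[ℂ] E) a : E →L[ℂ] E).toLinearMap
        (Polynomial.aeval R (∏ x ∈ s, (Polynomial.X - Polynomial.C x))).ker) ?_
    intro x hx
    rw [LinearMap.mem_ker, ContinuousLinearMap.coe_coe, hA, mul_apply_eq_comp] at hx
    exact hx

/-- If `R f = x f` with `x ≠ 0`, then `f = x⁻¹ R f` lies in the domain of `T` and `(T - t) f = x⁻¹
f`. -/
theorem IsResolvent.finiteDimensional_ker {T : E →ₗ.[ℂ] E} {t : ℂ} {R : E →L[ℂ] E}
    (hR : IsResolvent T t R) {x : ℂ} (hx : x ≠ 0)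
    (h : FiniteDimensional ℂ (eigenspace T (t + x⁻¹))) :
    FiniteDimensional ℂ (R - algebraMap ℂ (E →L[ℂ] E) x).ker := by
  refine Submodule.finiteDimensional_of_le
    (S₂ := (eigenspace T (t + x⁻¹)).map T.domain.subtype) ?_
  intro f hf
  have hf' : R f = x • f := by
    simpa [sub_eq_zero, Algebra.algebraMap_eq_smul_one] using hf
  obtain ⟨u, hu, huf⟩ := hR.1 f
  refine ⟨x⁻¹ • u, ?_, ?_⟩
  · rw [shift_apply, hu, hf', sub_eq_iff_eq_add] at huf
    rw [SetLike.mem_coe, mem_eigenspace_iff, LinearPMap.map_smul, huf, Submodule.coe_smul, hu, hf']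
    match_scalars
    field_simp
    ring
  · simp [hu, hf', hx]

/-- A symmetric operator whose negative real spectrum consists of eigenvalues of finite
multiplicity has infinitely many negative eigenvalues as soon as its quadratic form is negative
on an infinite sequence of vectors which are mutually orthogonal for the form. -/
theorem infinite_negativeEigenvalues [CompleteSpace E] {T : E →ₗ.[ℂ] E}
    (hsym : ∀ u v : T.domain, ⟪T u, (v : E)⟫_ℂ = ⟪(u : E), T v⟫_ℂ)
    (hspec : ∀ t : ℝ, t < 0 → (t : ℂ) ∈ spectrum T →
      HasEigenvalue T t ∧ FiniteDimensional ℂ (eigenspace T t))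
    (ψ : ℕ → T.domain) (hneg : ∀ n, (⟪(ψ n : E), T (ψ n)⟫_ℂ).re < 0)
    (horth : ∀ n m, n ≠ m → ⟪(ψ n : E), T (ψ m)⟫_ℂ = 0) :
    (negativeEigenvalues T).Infinite := by
  intro hfin
  obtain ⟨t, ht0, ht⟩ : ∃ t : ℝ, t < 0 ∧ t ∉ negativeEigenvalues T := by
    obtain ⟨t, ht, ht'⟩ := ((Set.Iio_infinite (0 : ℝ)).sdiff hfin).nonempty
    exact ⟨t, ht, ht'⟩
  obtain ⟨R, hR⟩ : ∃ R, IsResolvent T t R := by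
    by_contra hcon
    exact ht ⟨ht0, (hspec t ht0 hcon).1⟩
  have hRsa : IsSelfAdjoint R := hR.isSelfAdjoint hsym
  -- Since `x + t x² = x² (t + x⁻¹)`, these are the spectral points of `R` that correspond to
  -- negative spectrum of `T`.
  let S : Set ℝ := {x | x ∈ _root_.spectrum ℝ R ∧ x + t * x ^ 2 < 0}
  have hS (x : ℝ) (hx : x ∈ S) : x ≠ 0 ∧ t + x⁻¹ < 0 ∧ ((t + x⁻¹ : ℝ) : ℂ) ∈ spectrum T := by
    obtain ⟨hx1, hx2⟩ := hx
    have hx0 : x ≠ 0 := by rintro rfl; simp at hx2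
    have hlt : t + x⁻¹ < 0 := by
      have : x + t * x ^ 2 = x ^ 2 * (t + x⁻¹) := by field_simp; ring
      rw [this] at hx2
      exact neg_of_mul_neg_right hx2 (sq_nonneg x)
    refine ⟨hx0, hlt, ?_⟩
    have := hR.mem_spectrum_of_mem_spectrum (x := x) (by exact_mod_cast hx0)
      (by simpa using _root_.spectrum.algebraMap_mem ℂ hx1)
    simpa using this
  have hSfin : S.Finite := by
    refine Set.Finite.of_injOn (f := fun x => t + x⁻¹) (t := negativeEigenvalues T) ?_ ?_ hfin
    · intro x hx
      exact ⟨(hS x hx).2.1, (hspec _ (hS x hx).2.1 (hS x hx).2.2).1⟩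
    · intro x _ y _ hxy
      simpa using hxy
  -- The negative part of `x + t x²`. On the spectrum of `R` it vanishes off `S`, while `p` below
  -- vanishes on `S`, so the range of `G` lies in `ker p(R)`.
  let g : ℝ → ℝ := fun x => max 0 (-(x + t * x ^ 2))
  have hg : Continuous g := by fun_prop
  let G : E →L[ℂ] E := cfc g R
  let p : Polynomial ℝ := ∏ x ∈ hSfin.toFinset, (Polynomial.X - Polynomial.C x)
  have hpG : Polynomial.aeval R p * G = 0 := by
    rw [← cfc_polynomial p R, ← cfc_mul _ _ R (by fun_prop) hg.continuousOn]
    rw [← cfc_zero ℝ R]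
    refine cfc_congr fun x hx => ?_
    by_cases hxS : x + t * x ^ 2 < 0
    · have : p.eval x = 0 := by
        rw [Polynomial.eval_prod]
        exact Finset.prod_eq_zero (i := x) (by simpa using ⟨hx, hxS⟩) (by simp)
      simp [this]
    · have : g x = 0 := max_eq_left (by linarith)
      simp [this]
  have hker : FiniteDimensional ℂ (Polynomial.aeval R p).ker := by
    refine finiteDimensional_ker_aeval_prod R _ fun x hx => ?_
    have hx' := hS x (by simpa using hx)
    have e : ((t + x⁻¹ : ℝ) : ℂ) = t + (x : ℂ)⁻¹ := by push_cast; rfl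
    exact hR.finiteDimensional_ker (x := x) (by exact_mod_cast hx'.1)
      (e ▸ (hspec _ hx'.2.1 hx'.2.2).2)
  have hpos : 0 ≤ R + (t : ℂ) • (R * R) + G := by
    have : R + (t : ℂ) • (R * R) + G = cfc (fun x : ℝ => x + t * x ^ 2 + g x) R := by
      rw [cfc_add R (fun x : ℝ => x + t * x ^ 2) g, cfc_add R (fun x : ℝ => x) _,
        cfc_const_mul t (fun x : ℝ => x ^ 2) R, cfc_pow (fun x : ℝ => x) 2 R, cfc_id' ℝ R, sq]
      rfl
    rw [this]
    refine cfc_nonneg fun x _ => ?_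
    have := le_max_right 0 (-(x + t * x ^ 2))
    simp only [g]
    linarith
  let w : ℕ → (Polynomial.aeval R p).ker := fun n =>
    ⟨G (shift T t (ψ n)), by
      simpa using congrArg (fun A : E →L[ℂ] E => A (shift T t (ψ n))) hpG⟩
  -- Infinitely many vectors in a finite-dimensional space.
  have hdep : ¬ LinearIndependent ℂ w := fun hw => by
    have := hw.finite
    exact not_finite ℕ
  rw [linearIndependent_iff'] at hdep
  push Not at hdep
  obtain ⟨s, c, hc, i, his, hci⟩ := hdep
  let u : T.domain := ∑ n ∈ s, c n • ψ n
  have hGu : G (shift T t u) = 0 := by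
    have := congrArg Subtype.val hc
    simpa [u, w, map_sum] using this
  have h1 : 0 ≤ (⟪(u : E), T u⟫_ℂ).re := by
    have h2 := ((ContinuousLinearMap.nonneg_iff_isPositive _).mp hpos).re_inner_nonneg_right
      (shift T t u)
    have h3 : (R + (t : ℂ) • (R * R) + G) (shift T t u) = (u : E) + (t : ℂ) • R u := by
      simp [hGu, hR.2 u]
    have h4 : ⟪shift T t u, (u : E) + (t : ℂ) • R u⟫_ℂ = ⟪(u : E), T u⟫_ℂ := by
      have h5 : ⟪shift T t u, R u⟫_ℂ = ⟪(u : E), (u : E)⟫_ℂ := by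
        have := (ContinuousLinearMap.isSelfAdjoint_iff_isSymmetric.mp hRsa) (shift T t u) u
        simp only [ContinuousLinearMap.coe_coe] at this
        rw [← this, hR.2 u]
      rw [inner_add_right, inner_smul_right, h5, shift_apply, inner_sub_left, inner_smul_left,
        Complex.conj_ofReal, hsym]
      ring
    rw [h3, h4] at h2
    exact h2
  -- Form-orthogonality leaves only the diagonal terms.
  have h6 : ⟪(u : E), T u⟫_ℂ = ∑ n ∈ s, ((‖c n‖ ^ 2 : ℝ) : ℂ) * ⟪(ψ n : E), T (ψ n)⟫_ℂ := by
    have hTu : T u = ∑ n ∈ s, c n • T (ψ n) := by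
      change T.toFun u = ∑ n ∈ s, c n • T.toFun (ψ n)
      simp [u, map_sum]
    have hu : (u : E) = ∑ n ∈ s, c n • (ψ n : E) := by simp [u]
    rw [hTu, hu, sum_inner]
    refine Finset.sum_congr rfl fun n hn => ?_
    rw [inner_sum, Finset.sum_eq_single n]
    · rw [inner_smul_left, inner_smul_right, ← mul_assoc, Complex.conj_mul']
      norm_cast
    · intro m _ hmn
      rw [inner_smul_left, inner_smul_right, horth n m hmn.symm]
      simp
    · exact fun h => absurd hn h
  rw [h6, Complex.re_sum] at h1
  refine absurd h1 (not_le.mpr ?_)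
  refine Finset.sum_neg' (fun n _ => ?_) ⟨i, his, ?_⟩
  · rw [Complex.re_ofReal_mul]
    exact mul_nonpos_of_nonneg_of_nonpos (by positivity) (hneg n).le
  · rw [Complex.re_ofReal_mul]
    exact mul_neg_of_pos_of_neg (by positivity) (hneg i)

end Abstract

/-! ### Rescaled bump functions and their energy -/

section TestFunctions

theorem laplacian_comp_smul_sub {E F : Type*} [NormedAddCommGroup E] [InnerProductSpace ℝ E]
    [FiniteDimensional ℝ E] [NormedAddCommGroup F] [NormedSpace ℝ F] {f : E → F}
    (hf : ContDiff ℝ 2 f) (c : ℝ) (a x : E) :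
    (Δ fun y => f (c • (y - a))) x = c ^ 2 • (Δ f) (c • (x - a)) := by
  let L : E →L[ℝ] E := c • ContinuousLinearMap.id ℝ E
  have h : (fun y => f (c • (y - a))) = fun y => (f ∘ L) (y - a) := rfl
  simp only [InnerProductSpace.laplacian_eq_iteratedFDeriv_stdOrthonormalBasis]
  rw [h, iteratedFDeriv_comp_sub, L.iteratedFDeriv_comp_right hf _ le_rfl, Finset.smul_sum]
  refine Finset.sum_congr rfl fun i _ => ?_
  rw [ContinuousMultilinearMap.compContinuousLinearMap_apply]
  have h2 : (fun j : Fin 2 => L ((![stdOrthonormalBasis ℝ E i, stdOrthonormalBasis ℝ E i]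
      : Fin 2 → E) j)) =
      fun j => c • (![stdOrthonormalBasis ℝ E i, stdOrthonormalBasis ℝ E i] : Fin 2 → E) j := rfl
  rw [h2, ContinuousMultilinearMap.map_smul_univ]
  simp [L]

theorem laplacian_eq_zero_of_notMem_tsupport {E F : Type*} [NormedAddCommGroup E]
    [InnerProductSpace ℝ E] [FiniteDimensional ℝ E] [NormedAddCommGroup F] [NormedSpace ℝ F]
    {f : E → F} {x : E} (hx : x ∉ tsupport f) : (Δ f) x = 0 := by
  have h : f =ᶠ[𝓝 x] fun _ => 0 := notMem_tsupport_iff_eventuallyEq.mp hx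
  have := (InnerProductSpace.laplacian_congr_nhds h).self_of_nhds
  rw [this]
  simp

theorem continuous_laplacian {E F : Type*} [NormedAddCommGroup E]
    [InnerProductSpace ℝ E] [FiniteDimensional ℝ E] [NormedAddCommGroup F] [NormedSpace ℝ F]
    {f : E → F} (hf : ContDiff ℝ 2 f) : Continuous (Δ f) := by
  rw [InnerProductSpace.laplacian_eq_iteratedFDeriv_stdOrthonormalBasis]
  have := hf.continuous_iteratedFDeriv (m := 2) le_rfl
  fun_prop

variable (d : ℕ)

/-- A bump function supported in the closed ball of radius `1 / 4`. -/
def bump : ContDiffBump (0 : EuclideanSpace ℝ (Fin d)) :=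
  ⟨1 / 8, 1 / 4, by norm_num, by norm_num⟩

/-- The bump function as a complex-valued function. -/
def cbump (y : EuclideanSpace ℝ (Fin d)) : ℂ := bump d y

theorem contDiff_cbump {n : ℕ∞} : ContDiff ℝ n (cbump d) :=
  Complex.ofRealCLM.contDiff.comp (bump d).contDiff

theorem tsupport_cbump : tsupport (cbump d) = Metric.closedBall 0 (1 / 4) := by
  have : Function.support (cbump d) = Function.support (bump d) := by
    ext; simp [cbump]
  rw [tsupport, this]
  exact (bump d).tsupport_eq

/-- The density of the kinetic energy of the bump function. -/
def kinetic (y : EuclideanSpace ℝ (Fin d)) : ℝ := -(bump d y * ((Δ (cbump d)) y).re)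

theorem integrable_kinetic : Integrable (kinetic d) := by
  refine Continuous.integrable_of_hasCompactSupport ?_ ?_
  · have := continuous_laplacian (contDiff_cbump d (n := 2))
    have := (bump d).continuous
    unfold kinetic
    fun_prop
  · have : HasCompactSupport fun y => bump d y * ((Δ (cbump d)) y).re :=
      (bump d).hasCompactSupport.mul_right
    exact this.comp_left neg_zero

theorem integrable_bump_sq : Integrable fun y => bump d y ^ 2 := by
  refine Continuous.integrable_of_hasCompactSupport ?_ ?_
  · have := (bump d).continuous
    fun_prop
  · exact (bump d).hasCompactSupport.comp_left (g := fun t : ℝ => t ^ 2) (by simp)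

theorem integral_bump_sq_pos : 0 < ∫ y, bump d y ^ 2 := by
  refine Continuous.integral_pos_of_hasCompactSupport_nonneg_nonzero (x := 0) ?_ ?_ ?_ ?_
  · have := (bump d).continuous
    fun_prop
  · exact (bump d).hasCompactSupport.comp_left (g := fun t : ℝ => t ^ 2) (by simp)
  · intro y; positivity
  · have := (bump d).one_of_mem_closedBall (x := 0) (by simp [(bump d).rIn_pos.le])
    simp [this]

variable {d}

/-- The domain of `H` contains the test functions and `H = -Δ - σV` there. -/
def ActsOnTestFunctions (σ : ℝ) (V : EuclideanSpace ℝ (Fin d) → ℝ)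
    (H : L2 d →ₗ.[ℂ] L2 d) : Prop :=
  ∀ f : EuclideanSpace ℝ (Fin d) → ℂ, ContDiff ℝ ∞ f → HasCompactSupport f →
    ∃ ψ : H.domain, ((ψ : L2 d) : EuclideanSpace ℝ (Fin d) → ℂ) =ᵐ[volume] f ∧
      (H ψ : EuclideanSpace ℝ (Fin d) → ℂ) =ᵐ[volume]
        fun x => -(Δ f) x - (σ : ℂ) * ((V x : ℂ) * f x)

/-- The bump function moved to the ball with centre `a` and radius `s / 4`. -/
def spot (s : ℝ) (a y : EuclideanSpace ℝ (Fin d)) : ℂ := cbump d (s⁻¹ • (y - a))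

theorem contDiff_spot {n : ℕ∞} (s : ℝ) (a : EuclideanSpace ℝ (Fin d)) :
    ContDiff ℝ n (spot s a) :=
  (contDiff_cbump d).comp (by fun_prop)

theorem tsupport_spot_subset {s : ℝ} (hs : 0 < s) (a : EuclideanSpace ℝ (Fin d)) :
    tsupport (spot s a) ⊆ Metric.closedBall a (s / 4) := by
  refine closure_minimal ?_ Metric.isClosed_closedBall
  intro y hy
  have h : s⁻¹ • (y - a) ∈ tsupport (cbump d) := subset_tsupport _ hy
  rw [tsupport_cbump, mem_closedBall_zero_iff, norm_smul, norm_inv, Real.norm_of_nonneg hs.le,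
    inv_mul_le_iff₀ hs] at h
  rw [mem_closedBall_iff_norm]
  linarith

theorem hasCompactSupport_spot {s : ℝ} (hs : 0 < s) (a : EuclideanSpace ℝ (Fin d)) :
    HasCompactSupport (spot s a) :=
  (isCompact_closedBall a (s / 4)).of_isClosed_subset (isClosed_tsupport _)
    (tsupport_spot_subset hs a)

theorem laplacian_spot (s : ℝ) (a y : EuclideanSpace ℝ (Fin d)) :
    (Δ (spot s a)) y = (s⁻¹) ^ 2 • (Δ (cbump d)) (s⁻¹ • (y - a)) :=
  laplacian_comp_smul_sub (contDiff_cbump d (n := 2)) _ _ _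

theorem integral_comp_inv_smul_sub {s : ℝ} (a : EuclideanSpace ℝ (Fin d))
    (k : EuclideanSpace ℝ (Fin d) → ℝ) :
    ∫ y, k (s⁻¹ • (y - a)) = |s ^ d| * ∫ y, k y := by
  rw [integral_sub_right_eq_self (fun y => k (s⁻¹ • y)), Measure.integral_comp_inv_smul]
  simp

/-- The Laplacian and the lower bound on `V` both scale as `s⁻²`, so the condition on `σ` does not
depend on `s`. -/
theorem re_inner_spot_lt_zero {σ : ℝ} (hσ0 : 0 < σ)
    (hσ : 16 / 9 * (∫ y, kinetic d y) / (∫ y, bump d y ^ 2) < σ)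
    {V : EuclideanSpace ℝ (Fin d) → ℝ} {s : ℝ} (hs : 0 < s) {a : EuclideanSpace ℝ (Fin d)}
    (ha : ‖a‖ = s) (hV : ∀ᵐ y, y ∈ Metric.ball a (s / 3) → 1 / ‖y‖ ^ 2 ≤ V y)
    {ψ φ : L2 d} (hψ : (ψ : EuclideanSpace ℝ (Fin d) → ℂ) =ᵐ[volume] spot s a)
    (hφ : (φ : EuclideanSpace ℝ (Fin d) → ℂ) =ᵐ[volume]
      fun x => -(Δ (spot s a)) x - (σ : ℂ) * ((V x : ℂ) * spot s a x)) :
    (⟪ψ, φ⟫_ℂ).re < 0 := by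
  have hs' : s ≠ 0 := hs.ne'
  let k : EuclideanSpace ℝ (Fin d) → ℝ := fun z =>
    (s⁻¹) ^ 2 * (kinetic d z - σ * (9 / 16) * bump d z ^ 2)
  have hk : Integrable k :=
    ((integrable_kinetic d).sub ((integrable_bump_sq d).const_mul _)).const_mul _
  have hle : (⟪ψ, φ⟫_ℂ).re ≤ ∫ y, k (s⁻¹ • (y - a)) := by
    rw [L2.inner_def]
    have h0 := integral_re (L2.integrable_inner (𝕜 := ℂ) ψ φ)
    simp only [RCLike.re_to_complex] at h0
    rw [← h0]
    refine integral_mono_ae (L2.integrable_inner (𝕜 := ℂ) ψ φ).re ?_ ?_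
    · exact (hk.comp_smul (inv_ne_zero hs')).comp_sub_right a
    · filter_upwards [hψ, hφ, hV] with y h1 h2 h3
      rw [h1, h2, laplacian_spot]
      set z := s⁻¹ • (y - a) with hz
      have hsp : spot s a y = (bump d z : ℝ) := rfl
      have hre : (⟪(spot s a y : ℂ), -((s⁻¹) ^ 2 • (Δ (cbump d)) z) -
          (σ : ℂ) * ((V y : ℂ) * spot s a y)⟫_ℂ).re =
          (s⁻¹) ^ 2 * kinetic d z - σ * (V y * bump d z ^ 2) := by
        rw [hsp, RCLike.inner_apply]
        simp only [kinetic, Complex.conj_ofReal, Complex.re_mul_ofReal, Complex.sub_re,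
          Complex.neg_re, Complex.real_smul, Complex.re_ofReal_mul]
        norm_cast
        ring
      rw [hre]
      have hpot : (s⁻¹) ^ 2 * (9 / 16) * bump d z ^ 2 ≤ V y * bump d z ^ 2 := by
        by_cases hzb : bump d z = 0
        · simp [hzb]
        refine mul_le_mul_of_nonneg_right ?_ (sq_nonneg _)
        have hzn : ‖z‖ < 1 / 4 := by
          by_contra hcon
          exact hzb ((bump d).zero_of_le_dist (by simpa [bump] using hcon))
        rw [hz, norm_smul, norm_inv, Real.norm_of_nonneg hs.le, inv_mul_lt_iff₀ hs] at hzn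
        refine le_trans ?_ (h3 (by rw [mem_ball_iff_norm]; linarith))
        have h4 : ‖a‖ ≤ ‖y‖ + ‖y - a‖ := by
          simpa using norm_sub_le y (y - a)
        have h5 : ‖y‖ ≤ ‖y - a‖ + ‖a‖ := by
          simpa using norm_add_le (y - a) a
        have hy : 0 < ‖y‖ := by linarith
        rw [le_div_iff₀ (by positivity)]
        -- On the support `‖y‖ ≤ 5 s / 4`; the cruder bound `4 s / 3` is the source of `9/16`, and
        -- hence of `16/9` in the threshold.
        have : ‖y‖ ^ 2 ≤ (4 / 3 * s) ^ 2 := by gcongr; linarith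
        calc s⁻¹ ^ 2 * (9 / 16) * ‖y‖ ^ 2 ≤ s⁻¹ ^ 2 * (9 / 16) * (4 / 3 * s) ^ 2 := by gcongr
          _ = 1 := by field_simp; norm_num
      have := mul_le_mul_of_nonneg_left hpot hσ0.le
      simp only [k]
      linarith
  refine lt_of_le_of_lt hle ?_
  rw [integral_comp_inv_smul_sub, integral_const_mul, integral_sub (integrable_kinetic d)
    ((integrable_bump_sq d).const_mul _), integral_const_mul]
  have hB := integral_bump_sq_pos d
  rw [div_lt_iff₀ hB] at hσ
  refine mul_neg_of_pos_of_neg (by positivity) (mul_neg_of_pos_of_neg (by positivity) ?_)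
  linarith

/-- The balls carrying the two functions are disjoint, and the differential expression does not
enlarge supports. -/
theorem inner_spot_eq_zero {σ : ℝ} {V : EuclideanSpace ℝ (Fin d) → ℝ} {s r : ℝ} (hs : 0 < s)
    (hr : 0 < r) {a b : EuclideanSpace ℝ (Fin d)} (hab : s / 4 + r / 4 < ‖a - b‖)
    {ψ φ : L2 d} (hψ : (ψ : EuclideanSpace ℝ (Fin d) → ℂ) =ᵐ[volume] spot s a)
    (hφ : (φ : EuclideanSpace ℝ (Fin d) → ℂ) =ᵐ[volume]
      fun x => -(Δ (spot r b)) x - (σ : ℂ) * ((V x : ℂ) * spot r b x)) :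
    ⟪ψ, φ⟫_ℂ = 0 := by
  rw [L2.inner_def]
  refine integral_eq_zero_of_ae ?_
  filter_upwards [hψ, hφ] with y h1 h2
  rw [h1, h2]
  by_cases hy : y ∈ tsupport (spot s a)
  · have hy' : y ∉ tsupport (spot r b) := fun hy' => by
      have h3 := mem_closedBall_iff_norm.mp (tsupport_spot_subset hs a hy)
      have h4 := mem_closedBall_iff_norm.mp (tsupport_spot_subset hr b hy')
      have h5 : ‖a - b‖ ≤ ‖y - b‖ + ‖y - a‖ := by
        simpa using norm_sub_le (y - b) (y - a)
      linarith
    simp [laplacian_eq_zero_of_notMem_tsupport hy', image_eq_zero_of_notMem_tsupport hy']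
  · simp [image_eq_zero_of_notMem_tsupport hy]

/-- The distance is at least `2^m - 2^n`, and `3/4 * 2^m ≥ 3/2 * 2^n > 5/4 * 2^n`. -/
theorem add_div_four_lt_norm_sub {x : ℕ → EuclideanSpace ℝ (Fin d)}
    (hx : ∀ n, 1 ≤ n → ‖x n‖ = 2 ^ n) {n m : ℕ} (hn : 1 ≤ n) (hnm : n < m) :
    (2 : ℝ) ^ n / 4 + 2 ^ m / 4 < ‖x n - x m‖ := by
  have h1 : ‖x m‖ ≤ ‖x n‖ + ‖x n - x m‖ := by simpa using norm_sub_le (x n) (x n - x m)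
  rw [hx n hn, hx m (by omega)] at h1
  have h2 : (2 : ℝ) ^ (n + 1) ≤ 2 ^ m := pow_le_pow_right₀ (by norm_num) hnm
  have h3 : (0 : ℝ) < 2 ^ n := by positivity
  rw [pow_succ] at h2
  linarith

/-- Test functions supported in the balls have negative energy if the coupling constant is
large. -/
theorem exists_spots (d : ℕ) : ∃ σ₀ : ℝ, 0 < σ₀ ∧
    ∀ x : ℕ → EuclideanSpace ℝ (Fin d), (∀ n, 1 ≤ n → ‖x n‖ = 2 ^ n) →
    ∀ V : EuclideanSpace ℝ (Fin d) → ℝ,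
      (∀ n, 1 ≤ n → ∀ᵐ y, y ∈ Metric.ball (x n) (2 ^ n / 3) → 1 / ‖y‖ ^ 2 ≤ V y) →
    ∀ σ : ℝ, σ₀ < σ → ∀ H : L2 d →ₗ.[ℂ] L2 d, ActsOnTestFunctions σ V H →
      ∃ ψ : ℕ → H.domain, (∀ n, (⟪(ψ n : L2 d), H (ψ n)⟫_ℂ).re < 0) ∧
        ∀ n m, n ≠ m → ⟪(ψ n : L2 d), H (ψ m)⟫_ℂ = 0 := by
  -- The maximum with `1` makes `σ` positive, so that the lower bound on `V` may be multiplied by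
  -- it.
  refine ⟨max 1 (16 / 9 * (∫ y, kinetic d y) / (∫ y, bump d y ^ 2)), by positivity, ?_⟩
  intro x hx V hV σ hσ H hH
  obtain ⟨hσ1, hσ2⟩ := max_lt_iff.mp hσ
  -- The index is shifted because the points are constrained only from `1` on.
  choose ψ hψ hφ using fun n : ℕ => hH (spot (2 ^ (n + 1)) (x (n + 1)))
    (contDiff_spot _ _) (hasCompactSupport_spot (by positivity) _)
  refine ⟨ψ, fun n => ?_, fun n m hnm => ?_⟩
  · exact re_inner_spot_lt_zero (by linarith) hσ2 (by positivity) (hx _ (by omega))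
      (hV _ (by omega)) (hψ n) (hφ n)
  · refine inner_spot_eq_zero (by positivity) (by positivity) ?_ (hψ n) (hφ m)
    rcases lt_or_gt_of_ne hnm with h | h
    · exact add_div_four_lt_norm_sub hx (by omega) (by omega)
    · rw [norm_sub_rev, add_comm]
      exact add_div_four_lt_norm_sub hx (by omega) (by omega)

end TestFunctions

/-! ### Bounded multiplication operators and Fourier multipliers in `L²` -/

section Multipliers

open FourierTransform

variable {d : ℕ}

/-- Multiplication by an essentially bounded function, as an operator in `L²`. -/
def bddMul (g : EuclideanSpace ℝ (Fin d) → ℂ) (hg : MemLp g ∞ volume) : L2 d →L[ℂ] L2 d :=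
  (ContinuousLinearMap.mul ℂ ℂ).holderL volume ∞ 2 2 (hg.toLp g)

theorem coeFn_bddMul {g : EuclideanSpace ℝ (Fin d) → ℂ} (hg : MemLp g ∞ volume) (f : L2 d) :
    (bddMul g hg f : EuclideanSpace ℝ (Fin d) → ℂ) =ᵐ[volume] fun x => g x * f x := by
  filter_upwards [(ContinuousLinearMap.mul ℂ ℂ).coeFn_holder (r := 2) (hg.toLp g) f,
    hg.coeFn_toLp] with x h1 h2
  rw [bddMul, ContinuousLinearMap.holderL_apply_apply, h1, h2, ContinuousLinearMap.mul_apply']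

theorem norm_bddMul_le {g : EuclideanSpace ℝ (Fin d) → ℂ} (hg : MemLp g ∞ volume) {C : ℝ}
    (hC : 0 ≤ C) (h : ∀ᵐ x, ‖g x‖ ≤ C) : ‖bddMul g hg‖ ≤ C := by
  refine ContinuousLinearMap.opNorm_le_bound _ hC fun f => ?_
  refine Lp.norm_le_mul_norm_of_ae_le_mul ?_
  filter_upwards [coeFn_bddMul hg f, h] with x h1 h2
  rw [h1, norm_mul]
  gcongr

theorem bddMul_sub {g h : EuclideanSpace ℝ (Fin d) → ℂ} (hg : MemLp g ∞ volume)
    (hh : MemLp h ∞ volume) : bddMul g hg - bddMul h hh = bddMul (g - h) (hg.sub hh) := by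
  rw [bddMul, bddMul, bddMul, MemLp.toLp_sub, map_sub]

theorem bddMul_comp {g h k : EuclideanSpace ℝ (Fin d) → ℂ} (hg : MemLp g ∞ volume)
    (hh : MemLp h ∞ volume) (hk : MemLp k ∞ volume) (e : ∀ x, k x = g x * h x) :
    bddMul k hk = bddMul g hg ∘L bddMul h hh := by
  ext1 f
  apply Lp.ext
  filter_upwards [coeFn_bddMul hk f, coeFn_bddMul hg (bddMul h hh f), coeFn_bddMul hh f]
    with x h1 h2 h3
  rw [h1, ContinuousLinearMap.comp_apply, h2, h3, e, mul_assoc]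

theorem inner_bddMul {g : EuclideanSpace ℝ (Fin d) → ℝ}
    (hg : MemLp (fun x => (g x : ℂ)) ∞ volume) (f h : L2 d) :
    ⟪bddMul _ hg f, h⟫_ℂ = ⟪f, bddMul _ hg h⟫_ℂ := by
  rw [L2.inner_def, L2.inner_def]
  refine integral_congr_ae ?_
  filter_upwards [coeFn_bddMul hg f, coeFn_bddMul hg h] with x h1 h2
  rw [h1, h2, RCLike.inner_apply, RCLike.inner_apply, map_mul, Complex.conj_ofReal]
  ring

theorem toDistr_bddMul {g : EuclideanSpace ℝ (Fin d) → ℂ} (hg : MemLp g ∞ volume)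
    (hg' : g.HasTemperateGrowth) (f : L2 d) :
    toDistr d (bddMul g hg f) = smulLeftCLM ℂ g (toDistr d f) := by
  have : bddMul g hg f = (hg.toLp g • f : L2 d) := by
    apply Lp.ext
    filter_upwards [coeFn_bddMul hg f, Lp.coeFn_lpSMul (r := 2) (hg.toLp g) f, hg.coeFn_toLp]
      with x h1 h2 h3
    rw [h1, h2, Pi.smul_apply', h3, smul_eq_mul]
  rw [this]
  exact Lp.toTemperedDistribution_smul_eq hg' hg f

/-- The Fourier multiplier with a bounded symbol, as an operator in `L²`. -/
def fourierMul (g : EuclideanSpace ℝ (Fin d) → ℂ) (hg : MemLp g ∞ volume) : L2 d →L[ℂ] L2 d :=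
  (Lp.fourierTransformₗᵢ (EuclideanSpace ℝ (Fin d)) ℂ).symm.toContinuousLinearEquiv ∘L
    bddMul g hg ∘L (Lp.fourierTransformₗᵢ (EuclideanSpace ℝ (Fin d)) ℂ).toContinuousLinearEquiv

theorem fourierMul_apply {g : EuclideanSpace ℝ (Fin d) → ℂ} (hg : MemLp g ∞ volume) (f : L2 d) :
    fourierMul g hg f = 𝓕⁻ (bddMul g hg (𝓕 f)) := rfl

theorem norm_fourierMul_le {g : EuclideanSpace ℝ (Fin d) → ℂ} (hg : MemLp g ∞ volume) {C : ℝ}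
    (hC : 0 ≤ C) (h : ∀ᵐ x, ‖g x‖ ≤ C) : ‖fourierMul g hg‖ ≤ C := by
  refine ContinuousLinearMap.opNorm_le_bound _ hC fun f => ?_
  have h1 : ‖fourierMul g hg f‖ = ‖bddMul g hg (𝓕 f)‖ :=
    (Lp.fourierTransformₗᵢ (EuclideanSpace ℝ (Fin d)) ℂ).symm.norm_map _
  rw [h1, ← Lp.norm_fourier_eq f]
  exact (bddMul g hg).le_of_opNorm_le (norm_bddMul_le hg hC h) _

theorem fourierMul_sub {g h : EuclideanSpace ℝ (Fin d) → ℂ} (hg : MemLp g ∞ volume)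
    (hh : MemLp h ∞ volume) :
    fourierMul g hg - fourierMul h hh = fourierMul (g - h) (hg.sub hh) := by
  rw [fourierMul, fourierMul, fourierMul, ← bddMul_sub hg hh, ContinuousLinearMap.sub_comp,
    ContinuousLinearMap.comp_sub]

theorem fourierMul_comp {g h k : EuclideanSpace ℝ (Fin d) → ℂ} (hg : MemLp g ∞ volume)
    (hh : MemLp h ∞ volume) (hk : MemLp k ∞ volume) (e : ∀ x, k x = g x * h x) :
    fourierMul k hk = fourierMul g hg ∘L fourierMul h hh := by
  ext1 f
  rw [ContinuousLinearMap.comp_apply, fourierMul_apply, fourierMul_apply, fourierMul_apply,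
    bddMul_comp hg hh hk e, fourier_fourierInv_eq]
  rfl

theorem inner_fourierMul {g : EuclideanSpace ℝ (Fin d) → ℝ}
    (hg : MemLp (fun x => (g x : ℂ)) ∞ volume) (f h : L2 d) :
    ⟪fourierMul _ hg f, h⟫_ℂ = ⟪f, fourierMul _ hg h⟫_ℂ := by
  rw [← Lp.inner_fourier_eq, ← Lp.inner_fourier_eq f, fourierMul_apply, fourierMul_apply,
    fourier_fourierInv_eq, fourier_fourierInv_eq, inner_bddMul]

theorem toDistr_fourierMul {g : EuclideanSpace ℝ (Fin d) → ℂ} (hg : MemLp g ∞ volume)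
    (hg' : g.HasTemperateGrowth) (f : L2 d) :
    toDistr d (fourierMul g hg f) = fourierMultiplierCLM ℂ g (toDistr d f) := by
  have h1 : 𝓕 (toDistr d f) = toDistr d (𝓕 f) := Lp.fourier_toTemperedDistribution_eq f
  rw [fourierMultiplierCLM_apply, h1, ← toDistr_bddMul hg hg']
  exact (Lp.fourierInv_toTemperedDistribution_eq _).symm

end Multipliers

/-! ### The free resolvent `(-Δ + c)⁻¹` and symmetry of the Laplacian -/

section FreeResolvent

open Real

variable {d : ℕ}

/-- The symbol of `-Δ + c`. -/
def helmholtzSymbol (c : ℝ) (ξ : EuclideanSpace ℝ (Fin d)) : ℝ := (2 * π) ^ 2 * ‖ξ‖ ^ 2 + c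

/-- The symbol of `(-Δ + c)⁻¹`. -/
def resolventSymbol (c : ℝ) (ξ : EuclideanSpace ℝ (Fin d)) : ℝ := (helmholtzSymbol c ξ)⁻¹

theorem helmholtzSymbol_pos {c : ℝ} (hc : 0 < c) (ξ : EuclideanSpace ℝ (Fin d)) :
    0 < helmholtzSymbol c ξ := by
  unfold helmholtzSymbol
  positivity

theorem hasTemperateGrowth_helmholtzSymbol (c : ℝ) :
    (fun ξ : EuclideanSpace ℝ (Fin d) => (helmholtzSymbol c ξ : ℂ)).HasTemperateGrowth := by
  unfold helmholtzSymbol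
  fun_prop

theorem hasTemperateGrowth_resolventSymbol {c : ℝ} (hc : 0 < c) :
    (fun ξ : EuclideanSpace ℝ (Fin d) => (resolventSymbol c ξ : ℂ)).HasTemperateGrowth := by
  -- Up to the factor `c⁻¹`, the symbol is a dilation of the Bessel weight `(1 + ‖ξ‖²)⁻¹`.
  have h : (fun ξ : EuclideanSpace ℝ (Fin d) => (resolventSymbol c ξ : ℂ)) =
      fun ξ => ((c⁻¹ * (1 + ‖(2 * π / √c) • ξ‖ ^ 2) ^ (-1 : ℝ) : ℝ) : ℂ) := by
    ext ξ
    have h0 : ‖(2 * π / √c) • ξ‖ ^ 2 = (2 * π) ^ 2 / c * ‖ξ‖ ^ 2 := by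
      rw [norm_smul, mul_pow, Real.norm_of_nonneg (by positivity), div_pow, Real.sq_sqrt hc.le]
    rw [resolventSymbol, helmholtzSymbol, Real.rpow_neg_one, h0, ← mul_inv]
    congr 2
    field_simp
    ring
  rw [h]
  have h1 := (Function.hasTemperateGrowth_one_add_norm_sq_rpow
    (EuclideanSpace ℝ (Fin d)) (-1)).comp
      ((2 * π / √c) • ContinuousLinearMap.id ℝ (EuclideanSpace ℝ (Fin d))).hasTemperateGrowth
  have h2 : (fun ξ : EuclideanSpace ℝ (Fin d) =>
      (1 + ‖(2 * π / √c) • ξ‖ ^ 2) ^ (-1 : ℝ)).HasTemperateGrowth := h1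
  fun_prop

theorem resolventSymbol_nonneg {c : ℝ} (hc : 0 < c) (ξ : EuclideanSpace ℝ (Fin d)) :
    0 ≤ resolventSymbol c ξ := (inv_pos.mpr (helmholtzSymbol_pos hc ξ)).le

theorem resolventSymbol_le {c : ℝ} (hc : 0 < c) (ξ : EuclideanSpace ℝ (Fin d)) :
    resolventSymbol c ξ ≤ c⁻¹ := by
  refine inv_anti₀ hc ?_
  unfold helmholtzSymbol
  have : 0 ≤ (2 * π) ^ 2 * ‖ξ‖ ^ 2 := by positivity
  linarith

theorem memLp_resolventSymbol {c : ℝ} (hc : 0 < c) :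
    MemLp (fun ξ : EuclideanSpace ℝ (Fin d) => (resolventSymbol c ξ : ℂ)) ∞ volume := by
  refine memLp_top_of_bound
    (hasTemperateGrowth_resolventSymbol hc).1.continuous.aestronglyMeasurable c⁻¹
    (Eventually.of_forall fun ξ => ?_)
  rw [Complex.norm_real, Real.norm_of_nonneg (resolventSymbol_nonneg hc ξ)]
  exact resolventSymbol_le hc ξ

theorem helmholtz_eq_fourierMultiplierCLM (c : ℝ) (f : 𝓢'(EuclideanSpace ℝ (Fin d), ℂ)) :
    -(Δ f) + (c : ℂ) • f =
      fourierMultiplierCLM ℂ (fun ξ => (helmholtzSymbol c ξ : ℂ)) f := by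
  have h : (fun ξ : EuclideanSpace ℝ (Fin d) => (helmholtzSymbol c ξ : ℂ)) =
      (fun ξ => ((2 * π) ^ 2 : ℂ) • ((‖ξ‖ ^ 2 : ℝ) : ℂ)) + fun _ => (c : ℂ) := by
    ext ξ
    simp [helmholtzSymbol]
  have h1 : (fun ξ : EuclideanSpace ℝ (Fin d) => ((‖ξ‖ ^ 2 : ℝ) : ℂ)).HasTemperateGrowth := by
    fun_prop
  rw [laplacian_eq_fourierMultiplierCLM, h, fourierMultiplierCLM_apply, fourierMultiplierCLM_apply,
    smulLeftCLM_add (by fun_prop) (by fun_prop)]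
  have h2 := smulLeftCLM_smul (F := ℂ) h1 ((2 * π) ^ 2 : ℂ)
  have h3 : (fun ξ : EuclideanSpace ℝ (Fin d) => ((2 * π) ^ 2 : ℂ) • ((‖ξ‖ ^ 2 : ℝ) : ℂ)) =
    ((2 * π) ^ 2 : ℂ) • fun ξ => ((‖ξ‖ ^ 2 : ℝ) : ℂ) := rfl
  rw [h3, h2, _root_.add_apply, _root_.smul_apply, FourierTransform.fourierInv_add,
    FourierTransform.fourierInv_smul, smulLeftCLM_const, FourierTransform.fourierInv_smul,
    FourierTransform.fourierInv_fourier_eq]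
  congr 1
  rw [neg_smul, neg_neg, ← Complex.coe_smul]
  push_cast
  rfl

/-- The resolvent `(-Δ + c)⁻¹` in `L²`. -/
def freeResolvent (d : ℕ) {c : ℝ} (hc : 0 < c) : L2 d →L[ℂ] L2 d :=
  fourierMul _ (memLp_resolventSymbol hc)

theorem inner_freeResolvent {c : ℝ} (hc : 0 < c) (f g : L2 d) :
    ⟪freeResolvent d hc f, g⟫_ℂ = ⟪f, freeResolvent d hc g⟫_ℂ :=
  inner_fourierMul _ f g

theorem toDistr_freeResolvent {c : ℝ} (hc : 0 < c) (f : L2 d) :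
    toDistr d (freeResolvent d hc f) =
      fourierMultiplierCLM ℂ (fun ξ => (resolventSymbol c ξ : ℂ)) (toDistr d f) :=
  toDistr_fourierMul _ (hasTemperateGrowth_resolventSymbol hc) f

/-- The symbol times `1 + ‖ξ‖²` is bounded by `c⁻¹ + 1`, because `(2π)² ≥ 1`. -/
theorem freeResolvent_mem {c : ℝ} (hc : 0 < c) (f : L2 d) :
    freeResolvent d hc f ∈ sobolevH2 d := by
  change MemSobolev 2 2 (toDistr d (freeResolvent d hc f))
  have hb : (fun ξ : EuclideanSpace ℝ (Fin d) =>
      (((1 + ‖ξ‖ ^ 2) ^ ((2 : ℝ) / 2) : ℝ) : ℂ)).HasTemperateGrowth := by fun_prop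
  have ht := (hasTemperateGrowth_resolventSymbol (d := d) hc).mul hb
  have hbd : MemLp ((fun ξ : EuclideanSpace ℝ (Fin d) => (resolventSymbol c ξ : ℂ)) *
      fun ξ => (((1 + ‖ξ‖ ^ 2) ^ ((2 : ℝ) / 2) : ℝ) : ℂ)) ∞ volume := by
    refine memLp_top_of_bound ht.1.continuous.aestronglyMeasurable (c⁻¹ + 1)
      (Eventually.of_forall fun ξ => ?_)
    have h1 : (1 + ‖ξ‖ ^ 2) ^ ((2 : ℝ) / 2) = 1 + ‖ξ‖ ^ 2 := by
      rw [div_self two_ne_zero, Real.rpow_one]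
    rw [Pi.mul_apply, h1, ← Complex.ofReal_mul, Complex.norm_real,
      Real.norm_of_nonneg (mul_nonneg (resolventSymbol_nonneg hc ξ) (by positivity)),
      mul_add, mul_one]
    refine add_le_add (resolventSymbol_le hc ξ) ?_
    rw [resolventSymbol, inv_mul_le_iff₀ (helmholtzSymbol_pos hc ξ), mul_one, helmholtzSymbol]
    have h2 : 1 ≤ (2 * π) ^ 2 := one_le_pow₀ (by linarith [Real.pi_gt_three])
    nlinarith [sq_nonneg ‖ξ‖]
  refine ⟨fourierMul _ hbd f, ?_⟩
  rw [← Lp.toTemperedDistributionCLM_apply, toDistr_fourierMul hbd ht, toDistr_freeResolvent hc,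
    besselPotential,
    fourierMultiplierCLM_fourierMultiplierCLM_apply (hasTemperateGrowth_resolventSymbol hc) hb]

theorem toDistr_helmholtz (c : ℝ) (u : sobolevH2 d) :
    toDistr d (-laplacianL2 d u + (c : ℂ) • (u : L2 d)) =
      fourierMultiplierCLM ℂ (fun ξ => (helmholtzSymbol c ξ : ℂ)) (toDistr d u) := by
  rw [map_add, map_neg, map_smul, toDistr_laplacianL2, helmholtz_eq_fourierMultiplierCLM]

theorem resolventSymbol_mul_helmholtzSymbol {c : ℝ} (hc : 0 < c) :
    ((fun ξ : EuclideanSpace ℝ (Fin d) => (resolventSymbol c ξ : ℂ)) *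
      fun ξ => (helmholtzSymbol c ξ : ℂ)) = fun _ => 1 := by
  ext ξ
  rw [Pi.mul_apply, ← Complex.ofReal_mul, resolventSymbol,
    inv_mul_cancel₀ (helmholtzSymbol_pos hc ξ).ne', Complex.ofReal_one]

theorem helmholtz_freeResolvent {c : ℝ} (hc : 0 < c) (f : L2 d) (u : sobolevH2 d)
    (hu : (u : L2 d) = freeResolvent d hc f) :
    -laplacianL2 d u + (c : ℂ) • (u : L2 d) = f := by
  apply toDistr_injective
  rw [toDistr_helmholtz, hu, toDistr_freeResolvent,
    fourierMultiplierCLM_fourierMultiplierCLM_apply (hasTemperateGrowth_resolventSymbol hc)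
      (hasTemperateGrowth_helmholtzSymbol c), resolventSymbol_mul_helmholtzSymbol hc]
  simp

theorem freeResolvent_helmholtz {c : ℝ} (hc : 0 < c) (u : sobolevH2 d) :
    freeResolvent d hc (-laplacianL2 d u + (c : ℂ) • (u : L2 d)) = u := by
  apply toDistr_injective
  rw [toDistr_freeResolvent, toDistr_helmholtz,
    fourierMultiplierCLM_fourierMultiplierCLM_apply (hasTemperateGrowth_helmholtzSymbol c)
      (hasTemperateGrowth_resolventSymbol hc), mul_comm, resolventSymbol_mul_helmholtzSymbol hc]
  simp

/-- Symmetry is inherited from the bounded symmetric inverse `(-Δ + 1)⁻¹`. -/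
theorem inner_laplacianL2 (u v : sobolevH2 d) :
    ⟪laplacianL2 d u, (v : L2 d)⟫_ℂ = ⟪(u : L2 d), laplacianL2 d v⟫_ℂ := by
  have h := inner_freeResolvent (d := d) one_pos
    (-laplacianL2 d u + ((1 : ℝ) : ℂ) • (u : L2 d)) (-laplacianL2 d v + ((1 : ℝ) : ℂ) • (v : L2 d))
  rw [freeResolvent_helmholtz, freeResolvent_helmholtz] at h
  simp only [Complex.ofReal_one, one_smul, inner_add_left, inner_add_right, inner_neg_left,
    inner_neg_right, add_left_inj, neg_inj] at h
  exact h.symm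

end FreeResolvent

theorem isCompactOperator_of_forall_approx {E F : Type*} [NormedAddCommGroup E] [NormedSpace ℂ E]
    [NormedAddCommGroup F] [NormedSpace ℂ F] [CompleteSpace F] {T : E →L[ℂ] F}
    (h : ∀ ε : ℝ, 0 < ε → ∃ S : E →L[ℂ] F, IsCompactOperator S ∧ ‖T - S‖ ≤ ε) :
    IsCompactOperator T := by
  have hcl : IsClosed {S : E →L[ℂ] F | IsCompactOperator S} :=
    isClosed_setOfPred_isCompactOperator
  refine hcl.closure_subset_iff.mpr subset_rfl (Metric.mem_closure_iff.mpr fun ε hε => ?_)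
  obtain ⟨S, hS, hTS⟩ := h (ε / 2) (by positivity)
  exact ⟨S, hS, by rw [dist_eq_norm]; linarith⟩

/-! ### Compactness of operators with square-integrable kernels -/

section KernelOperators

variable {α : Type*} [MeasurableSpace α] (μ : Measure α) (H : Type*) [NormedAddCommGroup H]
  [NormedSpace ℂ H]

/-- The operator `φ ↦ (x ↦ k x φ)` into `L²` associated with a square-integrable family of
functionals. -/
def kernelOp : Lp (StrongDual ℂ H) 2 μ →L[ℂ] H →L[ℂ] Lp ℂ 2 μ :=
  (ContinuousLinearMap.compLpL₂ 2 μ (ContinuousLinearMap.apply ℂ ℂ)).flip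

variable {μ H}

theorem coeFn_kernelOp (k : Lp (StrongDual ℂ H) 2 μ) (φ : H) :
    (kernelOp μ H k φ : α → ℂ) =ᵐ[μ] fun x => k x φ :=
  ContinuousLinearMap.coeFn_compLp (ContinuousLinearMap.apply ℂ ℂ φ) k

/-- Indicator kernels give rank at most one; sums and norm limits of compact operators are compact.
-/
theorem isCompactOperator_kernelOp (k : Lp (StrongDual ℂ H) 2 μ) :
    IsCompactOperator (kernelOp μ H k) := by
  induction k using Lp.induction (p := 2) ENNReal.ofNat_ne_top with
  | @indicatorConst c s hs hμs =>
    have h : kernelOp μ H (Lp.simpleFunc.indicatorConst 2 hs hμs.ne c) =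
        (ContinuousLinearMap.toSpanSingleton ℂ (indicatorConstLp 2 hs hμs.ne (1 : ℂ))) ∘L c := by
      ext1 φ
      apply Lp.ext
      rw [Lp.simpleFunc.coe_indicatorConst, ContinuousLinearMap.comp_apply,
        ContinuousLinearMap.toSpanSingleton_apply]
      filter_upwards [coeFn_kernelOp (indicatorConstLp 2 hs hμs.ne c) φ,
        Lp.coeFn_smul (c φ) (indicatorConstLp 2 hs hμs.ne (1 : ℂ)),
        indicatorConstLp_coeFn (p := 2) (hs := hs) (hμs := hμs.ne) (c := c),
        indicatorConstLp_coeFn (p := 2) (hs := hs) (hμs := hμs.ne) (c := (1 : ℂ))]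
        with x h1 h2 h3 h4
      rw [h1, h2, h3, Pi.smul_apply, h4]
      by_cases hx : x ∈ s <;> simp [hx]
    rw [h]
    have hc : IsCompactOperator (c : H → ℂ) :=
      isCompactOperator_of_locallyCompactSpace_dom c
    exact hc.clm_comp (ContinuousLinearMap.toSpanSingleton ℂ _)
  | add hf hg _ ihf ihg =>
    rw [map_add]
    exact ihf.add ihg
  | isClosed =>
    have hcl : IsClosed {S : H →L[ℂ] Lp ℂ 2 μ | IsCompactOperator S} :=
      isClosed_setOfPred_isCompactOperator
    exact hcl.preimage (kernelOp μ H).continuous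

end KernelOperators

/-! ### Compactness of `V (-Δ + c)⁻¹` by cut-offs in space and frequency -/

section Cutoffs

open FourierTransform

variable {d : ℕ}

/-- The function `ξ ↦ e^{-2πi⟨x,ξ⟩} χ(ξ)`. -/
def modulated (χ : EuclideanSpace ℝ (Fin d) → ℝ) (x ξ : EuclideanSpace ℝ (Fin d)) : ℂ :=
  Complex.exp (-(2 * Real.pi * ⟪ξ, x⟫_ℝ : ℝ) * Complex.I) * χ ξ

theorem continuous_modulated {χ : EuclideanSpace ℝ (Fin d) → ℝ} (hχ : Continuous χ)
    (x : EuclideanSpace ℝ (Fin d)) : Continuous (modulated χ x) := by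
  unfold modulated
  fun_prop

theorem memLp_modulated {χ : EuclideanSpace ℝ (Fin d) → ℝ} (hχ : Continuous χ)
    (hχ' : HasCompactSupport χ) (x : EuclideanSpace ℝ (Fin d)) :
    MemLp (modulated χ x) 2 volume :=
  (continuous_modulated hχ x).memLp_of_hasCompactSupport
    ((hχ'.comp_left Complex.ofReal_zero).mul_left)

theorem norm_modulated_sub_le (χ : EuclideanSpace ℝ (Fin d) → ℝ)
    (x y ξ : EuclideanSpace ℝ (Fin d)) :
    ‖modulated χ x ξ - modulated χ y ξ‖ ≤ ‖x - y‖ * ‖2 * Real.pi * ‖ξ‖ * χ ξ‖ := by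
  have h (a b : ℝ) : ‖Complex.exp (a * Complex.I) - Complex.exp (b * Complex.I)‖ ≤ ‖a - b‖ := by
    have h1 : Complex.exp (a * Complex.I) - Complex.exp (b * Complex.I) =
        Complex.exp (b * Complex.I) * (Complex.exp (Complex.I * ((a - b : ℝ) : ℂ)) - 1) := by
      rw [mul_sub, ← Complex.exp_add, mul_one]
      congr 2
      push_cast
      ring
    rw [h1, norm_mul, Complex.norm_exp_ofReal_mul_I, one_mul]
    exact Real.norm_exp_I_mul_ofReal_sub_one_le
  rw [modulated, modulated, ← sub_mul, norm_mul, Complex.norm_real, norm_mul _ (χ ξ),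
    ← mul_assoc]
  refine mul_le_mul_of_nonneg_right ?_ (norm_nonneg _)
  rw [← Complex.ofReal_neg, ← Complex.ofReal_neg]
  refine (h _ _).trans ?_
  have h2 : -(2 * Real.pi * ⟪ξ, x⟫_ℝ) - -(2 * Real.pi * ⟪ξ, y⟫_ℝ) =
      2 * Real.pi * ⟪ξ, y - x⟫_ℝ := by
    rw [inner_sub_right]
    ring
  rw [h2, norm_mul, norm_mul (2 * Real.pi) ‖ξ‖, norm_norm, norm_sub_rev x y]
  calc ‖2 * Real.pi‖ * ‖⟪ξ, y - x⟫_ℝ‖ ≤ ‖2 * Real.pi‖ * (‖ξ‖ * ‖y - x‖) := by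
        gcongr
        exact norm_inner_le_norm ξ (y - x)
    _ = _ := by ring

/-- Continuity in `x` gives measurability, and boundedness on compact sets, of the kernel in
`restrictedFourier`. -/
theorem continuous_toLp_modulated {χ : EuclideanSpace ℝ (Fin d) → ℝ} (hχ : Continuous χ)
    (hχ' : HasCompactSupport χ) :
    Continuous fun x => (memLp_modulated hχ hχ' x).toLp (modulated χ x) := by
  have hg : MemLp (fun ξ : EuclideanSpace ℝ (Fin d) => 2 * Real.pi * ‖ξ‖ * χ ξ) 2 volume :=
    Continuous.memLp_of_hasCompactSupport (by fun_prop) hχ'.mul_left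
  refine (LipschitzWith.of_dist_le_mul (K := ‖hg.toLp‖₊) fun x y => ?_).continuous
  rw [dist_eq_norm, dist_eq_norm, mul_comm, coe_nnnorm]
  refine Lp.norm_le_mul_norm_of_ae_le_mul ?_
  rw [← MemLp.toLp_sub]
  filter_upwards [MemLp.coeFn_toLp ((memLp_modulated hχ hχ' x).sub (memLp_modulated hχ hχ' y)),
    hg.coeFn_toLp] with ξ h1 h2
  rw [h1, h2]
  exact norm_modulated_sub_le χ x y ξ

/-- The Fourier transform restricted to a set, as a family of functionals. -/
def restrictedFourier {χ : EuclideanSpace ℝ (Fin d) → ℝ} (hχ : Continuous χ)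
    (hχ' : HasCompactSupport χ) (s : Set (EuclideanSpace ℝ (Fin d))) :
    EuclideanSpace ℝ (Fin d) → StrongDual ℂ (L2 d) :=
  s.indicator fun x => innerSL ℂ ((memLp_modulated hχ hχ' x).toLp (modulated χ x))

theorem memLp_restrictedFourier {χ : EuclideanSpace ℝ (Fin d) → ℝ} (hχ : Continuous χ)
    (hχ' : HasCompactSupport χ) {s : Set (EuclideanSpace ℝ (Fin d))} (hs : IsCompact s) :
    MemLp (restrictedFourier hχ hχ' s) 2 volume := by
  have hc : Continuous fun x : EuclideanSpace ℝ (Fin d) =>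
      innerSL ℂ ((memLp_modulated hχ hχ' x).toLp (modulated χ x)) :=
    (innerSL ℂ).continuous.comp (continuous_toLp_modulated hχ hχ')
  refine (memLp_indicator_iff_restrict (ε := StrongDual ℂ (L2 d)) hs.measurableSet).mpr ?_
  have : IsFiniteMeasure (volume.restrict s) := ⟨by simpa using hs.measure_lt_top⟩
  obtain ⟨C, hC⟩ := hs.exists_bound_of_continuousOn hc.continuousOn
  exact MemLp.of_bound hc.aestronglyMeasurable C
    (ae_restrict_of_forall_mem hs.measurableSet hC)

theorem memLp_top_indicator_one {s : Set (EuclideanSpace ℝ (Fin d))} (hs : MeasurableSet s) :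
    MemLp (s.indicator fun _ => (1 : ℂ)) ∞ volume :=
  (memLp_top_const 1).indicator hs

theorem memLp_top_cutoff {χ : EuclideanSpace ℝ (Fin d) → ℝ} (hχ : Continuous χ)
    (hχ' : HasCompactSupport χ) : MemLp (fun ξ => (χ ξ : ℂ)) ∞ volume :=
  Continuous.memLp_of_hasCompactSupport (by fun_prop) (hχ'.comp_left Complex.ofReal_zero)

theorem fourierMul_toLp {g : EuclideanSpace ℝ (Fin d) → ℂ} (hg : MemLp g ∞ volume)
    (hg' : g.HasTemperateGrowth) (f : 𝓢(EuclideanSpace ℝ (Fin d), ℂ)) :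
    fourierMul g hg (f.toLp 2) = (𝓕⁻ (SchwartzMap.smulLeftCLM ℂ g (𝓕 f))).toLp 2 := by
  have hM : bddMul g hg ((𝓕 f).toLp 2) = (SchwartzMap.smulLeftCLM ℂ g (𝓕 f)).toLp 2 := by
    apply Lp.ext
    filter_upwards [coeFn_bddMul hg ((𝓕 f).toLp 2), (𝓕 f).coeFn_toLp 2 volume,
      (SchwartzMap.smulLeftCLM ℂ g (𝓕 f)).coeFn_toLp 2 volume] with ξ h1 h2 h3
    rw [h1, h2, h3, SchwartzMap.smulLeftCLM_apply_apply hg', smul_eq_mul]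
  rw [fourierMul_apply, SchwartzMap.toLp_fourier_eq, hM, SchwartzMap.toLp_fourierInv_eq]

/-- The inner product conjugates its first argument, which turns the phase into that of the inverse
Fourier transform. -/
theorem inner_modulated {χ : EuclideanSpace ℝ (Fin d) → ℝ} (hχ : Continuous χ)
    (hχ' : HasCompactSupport χ) (hχt : (fun ξ => (χ ξ : ℂ)).HasTemperateGrowth)
    (f : 𝓢(EuclideanSpace ℝ (Fin d), ℂ)) (x : EuclideanSpace ℝ (Fin d)) :
    ⟪(memLp_modulated hχ hχ' x).toLp (modulated χ x), f.toLp 2⟫_ℂ =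
      (𝓕⁻ (SchwartzMap.smulLeftCLM ℂ (fun ξ => (χ ξ : ℂ)) f)) x := by
  rw [L2.inner_def, SchwartzMap.fourierInv_coe, Real.fourierInv_eq']
  refine integral_congr_ae ?_
  filter_upwards [(memLp_modulated hχ hχ' x).coeFn_toLp, f.coeFn_toLp 2 volume] with ξ h5 h6
  rw [h5, h6, SchwartzMap.smulLeftCLM_apply_apply hχt, RCLike.inner_apply, modulated, map_mul,
    Complex.conj_ofReal, ← Complex.exp_conj, map_mul, Complex.conj_I, map_neg,
    Complex.conj_ofReal, neg_mul_neg]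
  simp only [smul_eq_mul]
  ring

/-- After a Fourier transform this is the operator with kernel `restrictedFourier`. The two agree on
Schwartz functions, where the inverse transform is a pointwise integral, and so everywhere by
density. -/
theorem isCompactOperator_indicator_fourierMul {χ : EuclideanSpace ℝ (Fin d) → ℝ}
    (hχ : ContDiff ℝ ∞ χ) (hχ' : HasCompactSupport χ) {s : Set (EuclideanSpace ℝ (Fin d))}
    (hs : IsCompact s) :
    IsCompactOperator (bddMul _ (memLp_top_indicator_one hs.measurableSet) ∘L
      fourierMul _ (memLp_top_cutoff hχ.continuous hχ')) := by
  let k := (memLp_restrictedFourier hχ.continuous hχ' hs).toLp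
  let F : L2 d →L[ℂ] L2 d :=
    (Lp.fourierTransformₗᵢ (EuclideanSpace ℝ (Fin d)) ℂ).toContinuousLinearEquiv
  have hχt : (fun ξ => (χ ξ : ℂ)).HasTemperateGrowth :=
    (hχ'.comp_left Complex.ofReal_zero).hasTemperateGrowth (Complex.ofRealCLM.contDiff.comp hχ)
  have h : bddMul _ (memLp_top_indicator_one hs.measurableSet) ∘L
      fourierMul _ (memLp_top_cutoff hχ.continuous hχ') = kernelOp volume (L2 d) k ∘L F := by
    refine ContinuousLinearMap.ext fun f => ?_
    refine DenseRange.induction_on (SchwartzMap.denseRange_toLpCLM (E := EuclideanSpace ℝ (Fin d))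
      (F := ℂ) (μ := volume) (p := 2) ENNReal.ofNat_ne_top) f ?_ ?_
    · exact isClosed_eq (ContinuousLinearMap.continuous _) (ContinuousLinearMap.continuous _)
    intro f
    rw [SchwartzMap.toLpCLM_apply, ContinuousLinearMap.comp_apply, ContinuousLinearMap.comp_apply]
    have hF : F (f.toLp 2) = (𝓕 f).toLp 2 := SchwartzMap.toLp_fourier_eq f
    rw [hF, fourierMul_toLp _ hχt]
    apply Lp.ext
    filter_upwards [coeFn_bddMul (memLp_top_indicator_one hs.measurableSet)
        ((𝓕⁻ (SchwartzMap.smulLeftCLM ℂ (fun ξ => (χ ξ : ℂ)) (𝓕 f))).toLp 2),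
      (𝓕⁻ (SchwartzMap.smulLeftCLM ℂ (fun ξ => (χ ξ : ℂ)) (𝓕 f))).coeFn_toLp 2 volume,
      coeFn_kernelOp k ((𝓕 f).toLp 2),
      (memLp_restrictedFourier hχ.continuous hχ' hs).coeFn_toLp] with x h1 h2 h3 h4
    rw [h1, h2, h3, h4, restrictedFourier]
    by_cases hx : x ∈ s
    · rw [Set.indicator_of_mem hx, Set.indicator_of_mem hx, one_mul, innerSL_apply_apply,
        inner_modulated hχ.continuous hχ' hχt]
    · simp [hx]
  rw [h]
  exact (isCompactOperator_kernelOp k).comp_clm F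

/-- A smooth cut-off function equal to `1` on the ball of radius `n + 1`. -/
def cutoff (d n : ℕ) : ContDiffBump (0 : EuclideanSpace ℝ (Fin d)) :=
  ⟨n + 1, n + 2, by positivity, by linarith⟩

theorem norm_resolventSymbol_sub_le {c : ℝ} (hc : 0 < c) (n : ℕ) (ξ : EuclideanSpace ℝ (Fin d)) :
    ‖(resolventSymbol c ξ : ℂ) - (cutoff d n ξ : ℂ) * (resolventSymbol c ξ : ℂ)‖ ≤
      1 / ((n : ℝ) + 1) := by
  by_cases h : ‖ξ‖ ≤ n + 1
  · rw [(cutoff d n).one_of_mem_closedBall (by simpa [cutoff] using h)]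
    simp
    positivity
  · have h1 : ‖(1 - cutoff d n ξ : ℝ)‖ ≤ 1 := by
      rw [Real.norm_of_nonneg (sub_nonneg.mpr (cutoff d n).le_one)]
      linarith [(cutoff d n).nonneg (x := ξ)]
    have h2 : (resolventSymbol c ξ : ℂ) - (cutoff d n ξ : ℂ) * (resolventSymbol c ξ : ℂ) =
        ((1 - cutoff d n ξ : ℝ) : ℂ) * (resolventSymbol c ξ : ℂ) := by
      push_cast
      ring
    rw [h2, norm_mul, Complex.norm_real, Complex.norm_real]
    refine (mul_le_of_le_one_left (norm_nonneg _) h1).trans ?_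
    rw [Real.norm_of_nonneg (resolventSymbol_nonneg hc ξ), resolventSymbol, one_div]
    refine inv_anti₀ (by positivity) ?_
    rw [helmholtzSymbol]
    have h3 : 1 ≤ (2 * Real.pi) ^ 2 := one_le_pow₀ (by linarith [Real.pi_gt_three])
    have h4 : (n : ℝ) + 1 ≤ ‖ξ‖ := (not_le.mp h).le
    have h5 : 0 ≤ (n : ℝ) := by positivity
    nlinarith [mul_le_mul_of_nonneg_right h3 (sq_nonneg ‖ξ‖)]

/-- The symbol decays at infinity, so truncating it in frequency changes the operator little in
norm. -/
theorem isCompactOperator_indicator_freeResolvent {c : ℝ} (hc : 0 < c)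
    {s : Set (EuclideanSpace ℝ (Fin d))} (hs : IsCompact s) :
    IsCompactOperator (bddMul _ (memLp_top_indicator_one hs.measurableSet) ∘L
      freeResolvent d hc) := by
  have hone : ‖bddMul _ (memLp_top_indicator_one hs.measurableSet)‖ ≤ 1 :=
    norm_bddMul_le _ zero_le_one (Eventually.of_forall fun x => by
      by_cases hx : x ∈ s <;> simp [hx])
  refine isCompactOperator_of_forall_approx fun ε hε => ?_
  obtain ⟨n, hn⟩ := exists_nat_one_div_lt hε
  have hχ := memLp_top_cutoff (cutoff d n).continuous (cutoff d n).hasCompactSupport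
  have hm := memLp_resolventSymbol (d := d) hc
  refine ⟨(bddMul _ (memLp_top_indicator_one hs.measurableSet) ∘L fourierMul _ hχ) ∘L
    freeResolvent d hc, ?_, ?_⟩
  · exact (isCompactOperator_indicator_fourierMul (cutoff d n).contDiff
      (cutoff d n).hasCompactSupport hs).comp_clm _
  · have hk : MemLp (fun ξ => (cutoff d n ξ : ℂ) * (resolventSymbol c ξ : ℂ)) ∞ volume :=
      hm.mul hχ
    rw [ContinuousLinearMap.comp_assoc, freeResolvent, ← fourierMul_comp hχ hm hk fun _ => rfl,
      ← ContinuousLinearMap.comp_sub, fourierMul_sub]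
    refine (ContinuousLinearMap.opNorm_comp_le _ _).trans ?_
    refine (mul_le_of_le_one_left (norm_nonneg _) hone).trans (le_trans ?_ hn.le)
    exact norm_fourierMul_le _ (by positivity)
      (Eventually.of_forall fun ξ => norm_resolventSymbol_sub_le hc n ξ)

theorem isCompactOperator_potential_freeResolvent {c : ℝ} (hc : 0 < c)
    {V : EuclideanSpace ℝ (Fin d) → ℝ} (hV : MemLp (fun x => (V x : ℂ)) ∞ volume)
    (hV' : VanishesAtInfinity V) :
    IsCompactOperator (bddMul _ hV ∘L freeResolvent d hc) := by
  refine isCompactOperator_of_forall_approx fun ε hε => ?_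
  -- The factor `c` compensates the bound `c⁻¹` for the norm of the free resolvent.
  obtain ⟨R, hR⟩ := hV' (ε * c) (by positivity)
  have hs : IsCompact (Metric.closedBall (0 : EuclideanSpace ℝ (Fin d)) R) :=
    isCompact_closedBall 0 R
  have h1 := memLp_top_indicator_one (d := d) hs.measurableSet
  have hk : MemLp (fun x => (V x : ℂ) *
      (Metric.closedBall (0 : EuclideanSpace ℝ (Fin d)) R).indicator (fun _ => (1 : ℂ)) x) ∞ volume :=
    h1.mul hV
  refine ⟨bddMul _ hV ∘L (bddMul _ h1 ∘L freeResolvent d hc),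
    (isCompactOperator_indicator_freeResolvent hc hs).clm_comp (bddMul _ hV), ?_⟩
  rw [← ContinuousLinearMap.comp_assoc, ← bddMul_comp hV h1 hk fun _ => rfl,
    ← ContinuousLinearMap.sub_comp, bddMul_sub]
  refine (ContinuousLinearMap.opNorm_comp_le _ _).trans ?_
  have h2 : ‖freeResolvent d hc‖ ≤ c⁻¹ := by
    refine norm_fourierMul_le _ (by positivity) (Eventually.of_forall fun ξ => ?_)
    rw [Complex.norm_real, Real.norm_of_nonneg (resolventSymbol_nonneg hc ξ)]
    exact resolventSymbol_le hc ξ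
  refine (mul_le_mul (norm_bddMul_le _ (C := ε * c) (by positivity) ?_) h2 (norm_nonneg _)
    (by positivity)).trans ?_
  · filter_upwards [hR] with x hx
    by_cases hxR : ‖x‖ ≤ R
    · simp [hxR]
      positivity
    · simpa [hxR] using hx (not_le.mp hxR).le
  · rw [mul_inv_cancel_right₀ hc.ne']

end Cutoffs

/-! ### The Schrödinger operator with bounded potential and the Birman–Schwinger principle -/

section Schrodinger

variable {d : ℕ} {σ : ℝ} {V : EuclideanSpace ℝ (Fin d) → ℝ}

theorem mulOp_eq_bddMul (hV : MemLp (fun x => (V x : ℂ)) ∞ volume) (u : mulDomain V) :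
    mulOp V u = bddMul _ hV u := by
  apply Lp.ext
  filter_upwards [MemLp.coeFn_toLp u.2, coeFn_bddMul hV u] with x h1 h2
  rw [h2]
  exact h1

theorem mem_mulDomain (hV : MemLp (fun x => (V x : ℂ)) ∞ volume) (u : L2 d) :
    u ∈ mulDomain V :=
  (Lp.memLp (bddMul _ hV u)).ae_eq (coeFn_bddMul hV u)

/-- The domain of the Schrödinger operator is contained in `H²`. -/
def domainInclusion (σ : ℝ) (V : EuclideanSpace ℝ (Fin d) → ℝ) :
    (schrodinger σ V).domain →ₗ[ℂ] sobolevH2 d :=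
  Submodule.inclusion (inf_le_left : sobolevH2 d ⊓ mulDomain V ≤ sobolevH2 d)

theorem coe_domainInclusion (u : (schrodinger σ V).domain) :
    (domainInclusion σ V u : L2 d) = u := rfl

theorem schrodinger_apply (hV : MemLp (fun x => (V x : ℂ)) ∞ volume)
    (u : (schrodinger σ V).domain) :
    schrodinger σ V u = -laplacianL2 d (domainInclusion σ V u) - (σ : ℂ) • bddMul _ hV u := by
  rw [← mulOp_eq_bddMul hV ⟨u, u.2.2⟩]
  rfl

theorem inner_schrodinger (hV : MemLp (fun x => (V x : ℂ)) ∞ volume)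
    (u v : (schrodinger σ V).domain) :
    ⟪schrodinger σ V u, (v : L2 d)⟫_ℂ = ⟪(u : L2 d), schrodinger σ V v⟫_ℂ := by
  have h := inner_laplacianL2 (domainInclusion σ V u) (domainInclusion σ V v)
  rw [coe_domainInclusion, coe_domainInclusion] at h
  rw [schrodinger_apply hV, schrodinger_apply hV, inner_sub_left, inner_sub_right, inner_neg_left,
    inner_neg_right, inner_smul_left, inner_smul_right, Complex.conj_ofReal, inner_bddMul, h]

theorem toDistr_toLp (f : 𝓢(EuclideanSpace ℝ (Fin d), ℂ)) :
    toDistr d (f.toLp 2 volume) = (f : 𝓢'(EuclideanSpace ℝ (Fin d), ℂ)) :=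
  Lp.toTemperedDistribution_toLp_eq f

theorem toLp_mem_sobolevH2 (f : 𝓢(EuclideanSpace ℝ (Fin d), ℂ)) :
    f.toLp 2 volume ∈ sobolevH2 d := by
  have h : MemSobolev 2 2 (f : 𝓢'(EuclideanSpace ℝ (Fin d), ℂ)) := f.memSobolev
  rw [← toDistr_toLp] at h
  exact h

theorem laplacianL2_toLp (f : 𝓢(EuclideanSpace ℝ (Fin d), ℂ)) (u : sobolevH2 d)
    (hu : (u : L2 d) = f.toLp 2 volume) : laplacianL2 d u = (Δ f).toLp 2 volume := by
  apply toDistr_injective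
  rw [toDistr_laplacianL2, hu, toDistr_toLp, toDistr_toLp, laplacian_toTemperedDistributionCLM_eq]

theorem actsOnTestFunctions_schrodinger (hV : MemLp (fun x => (V x : ℂ)) ∞ volume) :
    ActsOnTestFunctions σ V (schrodinger σ V) := by
  intro f hf hf'
  obtain ⟨F, hF⟩ : ∃ F : 𝓢(EuclideanSpace ℝ (Fin d), ℂ), ∀ x, F x = f x :=
    ⟨hf'.toSchwartzMap hf, fun _ => rfl⟩
  have hF' : (F : EuclideanSpace ℝ (Fin d) → ℂ) = f := funext hF
  obtain ⟨u, hu⟩ : ∃ u : (schrodinger σ V).domain, (u : L2 d) = F.toLp 2 volume :=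
    ⟨⟨F.toLp 2 volume, toLp_mem_sobolevH2 F, mem_mulDomain hV _⟩, rfl⟩
  have h0 := F.coeFn_toLp 2 volume
  refine ⟨u, by rw [hu, ← hF']; exact h0, ?_⟩
  rw [schrodinger_apply hV, laplacianL2_toLp F _ hu, hu]
  filter_upwards [Lp.coeFn_sub (-(Δ F).toLp 2 volume) ((σ : ℂ) • bddMul _ hV (F.toLp 2 volume)),
    Lp.coeFn_neg ((Δ F).toLp 2 volume), Lp.coeFn_smul (σ : ℂ) (bddMul _ hV (F.toLp 2 volume)),
    coeFn_bddMul hV (F.toLp 2 volume), h0, (Δ F).coeFn_toLp 2 volume]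
    with x h1 h2 h3 h4 h5 h6
  rw [h1, Pi.sub_apply, h2, Pi.neg_apply, h3, Pi.smul_apply, h4, h5, h6,
    SchwartzMap.laplacian_apply, hF', smul_eq_mul]

/-- The Birman–Schwinger operator `σ V (-Δ + c)⁻¹`. -/
def birmanSchwinger (σ : ℝ) (hV : MemLp (fun x => (V x : ℂ)) ∞ volume) {c : ℝ} (hc : 0 < c) :
    L2 d →L[ℂ] L2 d :=
  (σ : ℂ) • (bddMul _ hV ∘L freeResolvent d hc)

theorem isCompactOperator_birmanSchwinger (hV : MemLp (fun x => (V x : ℂ)) ∞ volume)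
    (hV' : VanishesAtInfinity V) {c : ℝ} (hc : 0 < c) :
    IsCompactOperator (birmanSchwinger σ hV hc) :=
  (isCompactOperator_potential_freeResolvent hc hV hV').smul (σ : ℂ)

/-- The vector `(-Δ + c) u`. -/
def helmholtz (σ : ℝ) (V : EuclideanSpace ℝ (Fin d) → ℝ) (c : ℝ) :
    (schrodinger σ V).domain →ₗ[ℂ] L2 d :=
  (-laplacianL2 d + (c : ℂ) • (sobolevH2 d).subtype) ∘ₗ domainInclusion σ V

theorem helmholtz_apply (c : ℝ) (u : (schrodinger σ V).domain) :
    helmholtz σ V c u = -laplacianL2 d (domainInclusion σ V u) +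
      (c : ℂ) • (domainInclusion σ V u : L2 d) := rfl

theorem freeResolvent_helmholtz_apply {c : ℝ} (hc : 0 < c) (u : (schrodinger σ V).domain) :
    freeResolvent d hc (helmholtz σ V c u) = u := by
  rw [helmholtz_apply, freeResolvent_helmholtz, coe_domainInclusion]

/-- The factorization `H - t = (1 - K)(-Δ - t)`, which transfers spectral questions at `t` to the
compact operator `K` at `1`. -/
theorem shift_schrodinger (hV : MemLp (fun x => (V x : ℂ)) ∞ volume) {t : ℝ} (ht : 0 < -t)
    (u : (schrodinger σ V).domain) :
    shift (schrodinger σ V) t u =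
      helmholtz σ V (-t) u - birmanSchwinger σ hV ht (helmholtz σ V (-t) u) := by
  rw [birmanSchwinger, _root_.smul_apply, ContinuousLinearMap.comp_apply,
    freeResolvent_helmholtz_apply, shift_apply, schrodinger_apply hV, helmholtz_apply,
    coe_domainInclusion]
  push_cast
  module

theorem exists_helmholtz_eq (hV : MemLp (fun x => (V x : ℂ)) ∞ volume) {c : ℝ} (hc : 0 < c)
    (f : L2 d) : ∃ u : (schrodinger σ V).domain,
      (u : L2 d) = freeResolvent d hc f ∧ helmholtz σ V c u = f := by
  obtain ⟨u, hu⟩ : ∃ u : (schrodinger σ V).domain, (u : L2 d) = freeResolvent d hc f :=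
    ⟨⟨freeResolvent d hc f, freeResolvent_mem hc f, mem_mulDomain hV _⟩, rfl⟩
  exact ⟨u, hu, by rw [helmholtz_apply, helmholtz_freeResolvent hc f _ hu]⟩

/-- The negative spectrum of a Schrödinger operator with a bounded potential vanishing at infinity
consists of eigenvalues of finite multiplicity. -/
theorem hasEigenvalue_schrodinger (hV : MemLp (fun x => (V x : ℂ)) ∞ volume)
    (hV' : VanishesAtInfinity V) {t : ℝ} (ht : t < 0)
    (hspec : (t : ℂ) ∈ spectrum (schrodinger σ V)) :
    HasEigenvalue (schrodinger σ V) t ∧ FiniteDimensional ℂ (eigenspace (schrodinger σ V) t) := by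
  have hc : 0 < -t := neg_pos.mpr ht
  set K := birmanSchwinger σ hV hc with hKdef
  have hK : IsCompactOperator K := isCompactOperator_birmanSchwinger hV hV' hc
  constructor
  · rcases hK.hasEigenvalue_or_mem_resolventSet one_ne_zero with h | h
    · obtain ⟨f, hf⟩ := h.exists_hasEigenvector
      obtain ⟨u, -, hu⟩ := exists_helmholtz_eq (σ := σ) hV hc f
      have hKf : K f = f := by simpa using hf.apply_eq_smul
      refine (Submodule.ne_bot_iff _).mpr ⟨u, ?_, ?_⟩
      · rw [eigenspace, LinearMap.mem_ker, shift_schrodinger hV hc, hu, ← hKdef, hKf, sub_self]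
      · rintro rfl
        exact hf.2 (by rw [← hu, map_zero])
    · exfalso
      apply hspec
      rw [_root_.spectrum.mem_resolventSet_iff, map_one] at h
      obtain ⟨⟨A, Q, hAQ, hQA⟩, rfl : A = 1 - K⟩ := h
      -- Here `Q = (1 - K)⁻¹`, so this is the inverse of the factorization.
      refine ⟨freeResolvent d hc ∘L Q, fun f => ?_, fun u => ?_⟩
      · obtain ⟨u, hu, hu'⟩ := exists_helmholtz_eq (σ := σ) hV hc (Q f)
        refine ⟨u, hu, ?_⟩
        rw [shift_schrodinger hV hc, hu']
        exact congrArg (fun A : L2 d →L[ℂ] L2 d => A f) hAQ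
      · rw [shift_schrodinger hV hc, ContinuousLinearMap.comp_apply]
        have : Q (helmholtz σ V (-t) u - K (helmholtz σ V (-t) u)) = helmholtz σ V (-t) u :=
          congrArg (fun A : L2 d →L[ℂ] L2 d => A (helmholtz σ V (-t) u)) hQA
        rw [← hKdef, this, freeResolvent_helmholtz_apply]
  -- The map `-Δ - t` embeds `ker (H - t)` into `ker (1 - K)`.
  · have := ContinuousLinearMap.finite_dimensional_eigenspace hK 1 one_ne_zero
    have hmem (u : eigenspace (schrodinger σ V) t) :
        helmholtz σ V (-t) u ∈ Module.End.eigenspace K.toLinearMap 1 := by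
      have h : shift (schrodinger σ V) t u = 0 := LinearMap.mem_ker.mp u.2
      rw [shift_schrodinger hV hc, sub_eq_zero] at h
      rw [Module.End.mem_eigenspace_iff, one_smul]
      exact h.symm
    refine FiniteDimensional.of_injective ((helmholtz σ V (-t) ∘ₗ
      (eigenspace (schrodinger σ V) t).subtype).codRestrict _ hmem) ?_
    intro u v huv
    have h : helmholtz σ V (-t) u = helmholtz σ V (-t) v := congrArg Subtype.val huv
    apply Subtype.ext
    apply Subtype.ext
    rw [← freeResolvent_helmholtz_apply hc, h, freeResolvent_helmholtz_apply hc]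

end Schrodinger

theorem inner_apply_of_isSelfAdjoint {E : Type*} [NormedAddCommGroup E] [InnerProductSpace ℂ E]
    [CompleteSpace E] {H : E →ₗ.[ℂ] E} (hH : IsSelfAdjoint H) (u v : H.domain) :
    ⟪H u, (v : E)⟫_ℂ = ⟪(u : E), H v⟫_ℂ := by
  have h := LinearPMap.adjoint_isFormalAdjoint hH.dense_domain
  rw [LinearPMap.isSelfAdjoint_def.mp hH] at h
  exact h u v

end LargeSpots

end

/-! ### The main theorem -/

theorem mainTheorem8 (d : ℕ) (hd : 3 ≤ d) :
    ∃ σ₀ : ℝ, 0 < σ₀ ∧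
      ∀ x : ℕ → EuclideanSpace ℝ (Fin d), (∀ n, 1 ≤ n → ‖x n‖ = 2 ^ n) →
      ∀ V : EuclideanSpace ℝ (Fin d) → ℝ, AEStronglyMeasurable V volume →
        (∀ n, 1 ≤ n → ∀ᵐ y, y ∈ Metric.ball (x n) (2 ^ n / 3) → 1 / ‖y‖ ^ 2 ≤ V y) →
      ∀ σ : ℝ, σ₀ < σ →
        ((MemLp V ∞ volume → LargeSpots.VanishesAtInfinity V →
            (LargeSpots.negativeEigenvalues (LargeSpots.schrodinger σ V)).Infinite) ∧
          (LocallyIntegrable (fun y => V y ^ 2) volume →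
            ∀ H : LargeSpots.L2 d →ₗ.[ℂ] LargeSpots.L2 d,
              LargeSpots.IsSelfAdjointRealization σ V H →
              LargeSpots.DiscreteNegativeSpectrum H →
              (LargeSpots.negativeEigenvalues H).Infinite)) := by
  obtain ⟨σ₀, hσ₀, h⟩ := LargeSpots.exists_spots d
  refine ⟨σ₀, hσ₀, fun x hx V _ hV σ hσ => ⟨fun hb hV' => ?_, fun _ H hH hdisc => ?_⟩⟩
  · have hb' : MemLp (fun x => (V x : ℂ)) ∞ volume := hb.ofReal
    obtain ⟨ψ, hneg, horth⟩ := h x hx V hV σ hσ _ (LargeSpots.actsOnTestFunctions_schrodinger hb')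
    exact LargeSpots.infinite_negativeEigenvalues (LargeSpots.inner_schrodinger hb')
      (fun t ht hspec => LargeSpots.hasEigenvalue_schrodinger hb' hV' ht hspec) ψ hneg horth
  · obtain ⟨ψ, hneg, horth⟩ := h x hx V hV σ hσ H hH.2
    exact LargeSpots.infinite_negativeEigenvalues (LargeSpots.inner_apply_of_isSelfAdjoint hH.1)
      (fun t ht hspec => (hdisc t ht hspec).2) ψ hneg horth
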